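/- **Theorem.** Let $\mathbb K$ be a field of characteristic zero. For a graded vector space $V$ with a finite homogeneous basis, let $\widehat T(V)=\prod_{n\ge 0}T^n(V)$ be the complete tensor algebra, with the graded commutator bracket $[x,y]=xy-(-1)^{|x||y|}yx$ (extended to series bilinearly, through even and odd parts), and let $\widehat{\mathbb L}(V)\subset\widehat T(V)$ be the complete free Lie algebra, i.e. the series $\sum_n\phi_n$ with every $\phi_n\in T^n(V)$ in the Lie subalgebra generated by $V$. Derivations of $\widehat T(V)$ and $\widehat{\mathbb L}(V)$ given by their values on generators are understood to be the continuous graded derivations with these values. Let $B_n$ be the Bernoulli numbers, with $\sum_n B_n t^n/n!=t/(e^t-1)$. Let $\mathfrak L=(\widehat{\mathbb L}(a,b,z),\partial)$ with $|a|=|b|=-1$, $|z|=0$ be the Lawrence–Sullivan construction: $\partial$ is the derivation of degree $-1$ with $$\partial a=-\tfrac12[a,a],\qquad \partial b=-\tfrac12[b,b],\qquad \partial z=[z,b]+\sum_{i\ge0}\frac{B_i}{i!}\,\mathrm{ad}_z^i(b-a).$$ Let $U\mathfrak L$ be its complete universal enveloping algebra: the inverse limit of the algebras $\mathcal U/I^n$,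 where $\mathcal U$ is the quotient of the tensor algebra of $\mathfrak L$ by the relations $xy-(-1)^{|x||y|}yx=[x,y]$ ($x,y$ even or odd) and $I$ is its augmentation ideal, with the degrees and the derivation induced by those of $\mathfrak L$. Let $\widehat{\mathrm{Cyl}}\,T(u)=(\widehat T(u\oplus u'\oplus su),D)$ with $|u|=|u'|=-1$, $|su|=0$, where $D$ is the derivation of degree $-1$ with $Du=-u\otimes u$, $Du'=-u'\otimes u'$ and $$D\,su=su\otimes u'-u'\otimes su+\sum_{n\ge0}\ \sum_{p+q=n}(-1)^q\frac{B_n}{p!\,q!}\;su^{\otimes p}\otimes(u'-u)\otimes su^{\otimes q}.$$ Then $D^2=0$, the derivations of $\mathfrak L$ and of $U\mathfrak L$ square to zero as well, and there is an isomorphism of differential graded algebras $U\mathfrak L\cong\widehat{\mathrm{Cyl}}\,T(u)$ (an algebra isomorphism that identifies the homogeneous elements of each degree and the parity operators $x\mapsto(-1)^{|x|}x$, and commutes with the differentials) which sends $a,b,z$ to $u,u',su$ respectively. -/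

import Mathlib

open Finset

noncomputable section

/-! ### Graded associative and Lie algebras with a derivation of degree `-1` -/

/-- A graded associative algebra (possibly complete) with a degree `-1` derivation `diff`.
`deg p` is the space of homogeneous elements of degree `p`, and `parity` is the operator
`x ↦ (-1)^|x| x`. Since elements may be infinite series, the whole algebra is not required to
be the direct sum of the `deg p`. It is a DGA when `diff` squares to zero: see `IsDGA`. -/
structure PreDGA (K A : Type*) [Field K] [Ring A] [Algebra K A] where
  deg : ℤ → Submodule K A
  parity : A →ₐ[K] A
  diff : A →ₗ[K] A
  one_mem : (1 : A) ∈ deg 0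
  mul_mem : ∀ {p q : ℤ} {x y : A}, x ∈ deg p → y ∈ deg q → x * y ∈ deg (p + q)
  parity_apply : ∀ {p : ℤ} {x : A}, x ∈ deg p → parity x = (-1 : K) ^ p • x
  parity_parity : ∀ x : A, parity (parity x) = x
  diff_mem : ∀ {p : ℤ} {x : A}, x ∈ deg p → diff x ∈ deg (p - 1)
  parity_diff : ∀ x : A, parity (diff x) = -diff (parity x)
  leibniz : ∀ x y : A, diff (x * y) = diff x * y + parity x * diff y

/-- The derivation is a differential. -/
def PreDGA.IsDGA {K A : Type*} [Field K] [Ring A] [Algebra K A] (𝒜 : PreDGA K A) : Prop :=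
  ∀ x : A, 𝒜.diff (𝒜.diff x) = 0

/-- `φ` respects degrees and commutes with the derivations. -/
structure PreDGA.IsIso {K A B : Type*} [Field K] [Ring A] [Algebra K A] [Ring B] [Algebra K B]
    (𝒜 : PreDGA K A) (ℬ : PreDGA K B) (φ : A ≃ₐ[K] B) : Prop where
  mem_deg_iff : ∀ (p : ℤ) (x : A), φ x ∈ ℬ.deg p ↔ x ∈ 𝒜.deg p
  map_parity : ∀ x : A, φ (𝒜.parity x) = ℬ.parity (φ x)
  map_diff : ∀ x : A, φ (𝒜.diff x) = ℬ.diff (φ x)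

/-- A graded Lie algebra (possibly complete) with a degree `-1` derivation `diff`.
`x` is even or odd when `parity x = x` or `parity x = -x`; the graded laws are stated for even
and odd elements, so in particular for homogeneous ones. It is a DGL when `diff` squares to
zero: see `IsDGL`. -/
structure PreDGL (K L : Type*) [Field K] [AddCommGroup L] [Module K L] where
  deg : ℤ → Submodule K L
  parity : L →ₗ[K] L
  bracket : L →ₗ[K] L →ₗ[K] L
  diff : L →ₗ[K] L
  parity_apply : ∀ {p : ℤ} {x : L}, x ∈ deg p → parity x = (-1 : K) ^ p • x
  parity_parity : ∀ x : L, parity (parity x) = x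
  parity_bracket : ∀ x y : L, parity (bracket x y) = bracket (parity x) (parity y)
  bracket_mem : ∀ {p q : ℤ} {x y : L}, x ∈ deg p → y ∈ deg q → bracket x y ∈ deg (p + q)
  antisymm : ∀ {i j : ℤ} {x y : L}, parity x = (-1 : K) ^ i • x → parity y = (-1 : K) ^ j • y →
    bracket x y = -((-1 : K) ^ (i * j) • bracket y x)
  jacobi : ∀ {i j : ℤ} {x y : L} (z : L),
    parity x = (-1 : K) ^ i • x → parity y = (-1 : K) ^ j • y →
    bracket x (bracket y z) = bracket (bracket x y) z + (-1 : K) ^ (i * j) • bracket y (bracket x z)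
  diff_mem : ∀ {p : ℤ} {x : L}, x ∈ deg p → diff x ∈ deg (p - 1)
  parity_diff : ∀ x : L, parity (diff x) = -diff (parity x)
  leibniz : ∀ x y : L, diff (bracket x y) = bracket (diff x) y + bracket (parity x) (diff y)

/-- The derivation is a differential. -/
def PreDGL.IsDGL {K L : Type*} [Field K] [AddCommGroup L] [Module K L] (𝔤 : PreDGL K L) : Prop :=
  ∀ x : L, 𝔤.diff (𝔤.diff x) = 0

theorem neg_one_zpow_cases {K : Type*} [Field K] (i : ℤ) :
    (Even i ∧ (-1 : K) ^ i = 1) ∨ (Odd i ∧ (-1 : K) ^ i = -1) := by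
  rcases Int.even_or_odd i with h | h
  · exact Or.inl ⟨h, h.neg_one_zpow⟩
  · exact Or.inr ⟨h, h.neg_one_zpow⟩

/-! ### The complete universal enveloping algebra -/

namespace PreDGL

variable {K L : Type*} [Field K] [AddCommGroup L] [Module K L] (𝔤 : PreDGL K L)

/-- The relations `x y = (-1)^(|x||y|) y x + [x, y]` in the tensor algebra of `L`. -/
inductive URel : TensorAlgebra K L → TensorAlgebra K L → Prop
  | comm {i j : ℤ} {x y : L} (hx : 𝔤.parity x = (-1 : K) ^ i • x)
      (hy : 𝔤.parity y = (-1 : K) ^ j • y) :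
      URel (TensorAlgebra.ι K x * TensorAlgebra.ι K y)
        ((-1 : K) ^ (i * j) • (TensorAlgebra.ι K y * TensorAlgebra.ι K x)
          + TensorAlgebra.ι K (𝔤.bracket x y))

/-- The (uncompleted) universal enveloping algebra of a graded Lie algebra. -/
def U : Type _ := RingQuot 𝔤.URel

instance : Ring 𝔤.U := inferInstanceAs (Ring (RingQuot 𝔤.URel))

instance : Algebra K 𝔤.U := inferInstanceAs (Algebra K (RingQuot 𝔤.URel))

/-- The quotient map of the tensor algebra onto the enveloping algebra. -/
def mkU : TensorAlgebra K L →ₐ[K] 𝔤.U := RingQuot.mkAlgHom K 𝔤.URel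

theorem mkU_surjective : Function.Surjective 𝔤.mkU := RingQuot.mkAlgHom_surjective K 𝔤.URel

/-- The canonical map of a Lie algebra to its enveloping algebra. -/
def ι : L →ₗ[K] 𝔤.U := 𝔤.mkU.toLinearMap ∘ₗ TensorAlgebra.ι K

theorem ι_mul_ι {i j : ℤ} {x y : L} (hx : 𝔤.parity x = (-1 : K) ^ i • x)
    (hy : 𝔤.parity y = (-1 : K) ^ j • y) :
    𝔤.ι x * 𝔤.ι y = (-1 : K) ^ (i * j) • (𝔤.ι y * 𝔤.ι x) + 𝔤.ι (𝔤.bracket x y) := by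
  have h : 𝔤.mkU _ = 𝔤.mkU _ := RingQuot.mkAlgHom_rel K (URel.comm (𝔤 := 𝔤) hx hy)
  simpa [ι] using h

theorem U_induction {P : 𝔤.U → Prop} (hK : ∀ r : K, P (algebraMap K 𝔤.U r))
    (hι : ∀ x, P (𝔤.ι x)) (hadd : ∀ a b, P a → P b → P (a + b))
    (hmul : ∀ a b, P a → P b → P (a * b)) (u : 𝔤.U) : P u := by
  obtain ⟨t, rfl⟩ := 𝔤.mkU_surjective u
  induction t using TensorAlgebra.induction with
  | algebraMap r => simpa using hK r
  | ι x => exact hι x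
  | mul a b ha hb => rw [map_mul]; exact hmul _ _ ha hb
  | add a b ha hb => rw [map_add]; exact hadd _ _ ha hb

/-- The algebra map out of the enveloping algebra given by a linear map respecting brackets. -/
def lift {A : Type*} [Ring A] [Algebra K A] (f : L →ₗ[K] A)
    (hf : ∀ {i j : ℤ} {x y : L}, 𝔤.parity x = (-1 : K) ^ i • x →
      𝔤.parity y = (-1 : K) ^ j • y →
      f x * f y = (-1 : K) ^ (i * j) • (f y * f x) + f (𝔤.bracket x y)) : 𝔤.U →ₐ[K] A :=
  RingQuot.liftAlgHom K ⟨TensorAlgebra.lift K f, by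
    rintro _ _ ⟨hx, hy⟩
    simpa using hf hx hy⟩

@[simp] theorem lift_ι {A : Type*} [Ring A] [Algebra K A] (f : L →ₗ[K] A) (hf) (x : L) :
    𝔤.lift f hf (𝔤.ι x) = f x := by
  have h : 𝔤.lift f hf (𝔤.ι x) = TensorAlgebra.lift K f (TensorAlgebra.ι K x) :=
    RingQuot.liftAlgHom_mkAlgHom_apply ..
  rw [h, TensorAlgebra.lift_ι_apply]

/-- The augmentation of the enveloping algebra, killing `L`. -/
def aug : 𝔤.U →ₐ[K] K := 𝔤.lift 0 (by simp)

/-- The augmentation ideal. -/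
abbrev augIdeal : Ideal 𝔤.U := RingHom.ker 𝔤.aug

/-- The parity operator of the enveloping algebra. -/
def parityU : 𝔤.U →ₐ[K] 𝔤.U := 𝔤.lift (𝔤.ι ∘ₗ 𝔤.parity) (by
  intro i j x y hx hy
  have h := 𝔤.ι_mul_ι hx hy
  simp only [LinearMap.comp_apply, 𝔤.parity_bracket, hx, hy, map_smul, LinearMap.smul_apply,
    smul_mul_smul_comm, h, smul_add, smul_smul]
  congr 2 <;> ring)

/-- The algebra map `u ↦ !![parity u, d u; 0, u]`, which encodes the derivation `d` of the
enveloping algebra that extends the one of `L`. -/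
def rhoU : 𝔤.U →ₐ[K] Matrix (Fin 2) (Fin 2) 𝔤.U :=
  𝔤.lift
    { toFun := fun x => !![𝔤.ι (𝔤.parity x), 𝔤.ι (𝔤.diff x); 0, 𝔤.ι x]
      map_add' := fun x y => by ext i j; fin_cases i <;> fin_cases j <;> simp
      map_smul' := fun r x => by ext i j; fin_cases i <;> fin_cases j <;> simp }
    (by
      intro i j x y hx hy
      have hdx : 𝔤.parity (𝔤.diff x) = (-1 : K) ^ (i + 1) • 𝔤.diff x := by
        rw [𝔤.parity_diff, hx, map_smul, zpow_add₀ (by simp)]; simp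
      have hdy : 𝔤.parity (𝔤.diff y) = (-1 : K) ^ (j + 1) • 𝔤.diff y := by
        rw [𝔤.parity_diff, hy, map_smul, zpow_add₀ (by simp)]; simp
      have h := 𝔤.ι_mul_ι hx hy
      have h1 := 𝔤.ι_mul_ι hdx hy
      have h2 := 𝔤.ι_mul_ι hx hdy
      have hs : ∀ k : ℤ, (-1 : K) ^ k * (-1 : K) ^ k = 1 := fun k => by
        rcases neg_one_zpow_cases (K := K) k with h | h <;> simp [h.2]
      rw [add_mul, one_mul, zpow_add₀ (by simp)] at h1
      rw [mul_add, mul_one, zpow_add₀ (by simp)] at h2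
      ext a b
      fin_cases a <;> fin_cases b
      · simp only [LinearMap.coe_mk, AddHom.coe_mk, 𝔤.parity_bracket, hx, hy, map_smul,
          LinearMap.smul_apply]
        simp [h, smul_smul]
        congr 2 <;> ring
      · simp only [LinearMap.coe_mk, AddHom.coe_mk, 𝔤.leibniz, hx, hy, map_smul, map_add]
        simp [h1, h2, smul_smul, LinearMap.smul_apply]
        rw [← mul_assoc, mul_comm ((-1 : K) ^ i), mul_assoc, hs]
        simp
        abel
      · simp
      · simp [h])

/-- The derivation of the enveloping algebra that extends the one of `L`. -/
def diffU : 𝔤.U →ₗ[K] 𝔤.U where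
  toFun u := 𝔤.rhoU u 0 1
  map_add' := by simp
  map_smul' := by simp

@[simp] theorem parityU_ι (x : L) : 𝔤.parityU (𝔤.ι x) = 𝔤.ι (𝔤.parity x) := by simp [parityU]

@[simp] theorem diffU_ι (x : L) : 𝔤.diffU (𝔤.ι x) = 𝔤.ι (𝔤.diff x) := by simp [diffU, rhoU]

@[simp] theorem aug_ι (x : L) : 𝔤.aug (𝔤.ι x) = 0 := by simp [aug]

theorem rhoU_apply (u : 𝔤.U) : 𝔤.rhoU u = !![𝔤.parityU u, 𝔤.diffU u; 0, u] := by
  have : 𝔤.rhoU u 0 0 = 𝔤.parityU u ∧ 𝔤.rhoU u 1 0 = 0 ∧ 𝔤.rhoU u 1 1 = u := by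
    induction u using 𝔤.U_induction with
    | hK r => simp [Matrix.algebraMap_matrix_apply]
    | hι x => simp [rhoU]
    | hadd a b ha hb => simp [ha, hb]
    | hmul a b ha hb => simp [Matrix.mul_apply, Fin.sum_univ_two, ha, hb]
  obtain ⟨h1, h2, h3⟩ := this
  ext a b
  fin_cases a <;> fin_cases b <;> simp [h1, h2, h3, diffU]

theorem diffU_mul (a b : 𝔤.U) :
    𝔤.diffU (a * b) = 𝔤.diffU a * b + 𝔤.parityU a * 𝔤.diffU b := by
  have h := congrFun (congrFun (map_mul 𝔤.rhoU a b) 0) 1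
  rw [𝔤.rhoU_apply, 𝔤.rhoU_apply a, 𝔤.rhoU_apply b] at h
  simp [Matrix.mul_apply, Fin.sum_univ_two] at h
  rw [h, add_comm]

theorem diffU_algebraMap (r : K) : 𝔤.diffU (algebraMap K 𝔤.U r) = 0 := by
  simp [diffU, Matrix.algebraMap_matrix_apply]

theorem parityU_parityU (u : 𝔤.U) : 𝔤.parityU (𝔤.parityU u) = u := by
  induction u using 𝔤.U_induction with
  | hK r => simp
  | hι x => simp [𝔤.parity_parity]
  | hadd a b ha hb => simp [ha, hb]
  | hmul a b ha hb => simp [ha, hb]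

theorem parityU_diffU (u : 𝔤.U) : 𝔤.parityU (𝔤.diffU u) = -𝔤.diffU (𝔤.parityU u) := by
  induction u using 𝔤.U_induction with
  | hK r => simp [diffU_algebraMap]
  | hι x => simp [𝔤.parity_diff]
  | hadd a b ha hb => simp [ha, hb, add_comm]
  | hmul a b ha hb =>
    simp only [diffU_mul, map_add, map_mul, ha, hb, parityU_parityU, neg_mul, mul_neg, neg_add]

theorem aug_parityU (u : 𝔤.U) : 𝔤.aug (𝔤.parityU u) = 𝔤.aug u := by
  induction u using 𝔤.U_induction with
  | hK r => simp
  | hι x => simp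
  | hadd a b ha hb => simp [ha, hb]
  | hmul a b ha hb => simp [ha, hb]

theorem aug_diffU (u : 𝔤.U) : 𝔤.aug (𝔤.diffU u) = 0 := by
  induction u using 𝔤.U_induction with
  | hK r => simp [diffU_algebraMap]
  | hι x => simp
  | hadd a b ha hb => simp [ha, hb]
  | hmul a b ha hb => simp [diffU_mul, ha, hb]

theorem parityU_mem_pow (n : ℕ) {u : 𝔤.U} (hu : u ∈ 𝔤.augIdeal ^ n) :
    𝔤.parityU u ∈ 𝔤.augIdeal ^ n := by
  induction n generalizing u with
  | zero => rw [Submodule.pow_zero, Ideal.one_eq_top]; exact Submodule.mem_top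
  | succ n ih =>
    rw [Ideal.IsTwoSided.pow_succ] at hu ⊢
    induction hu using Submodule.smul_induction_on' with
    | smul a ha b hb =>
      rw [smul_eq_mul, map_mul]
      exact Ideal.mul_mem_mul (by simpa [RingHom.mem_ker, aug_parityU] using ha) (ih hb)
    | add a _ b _ ha hb => rw [map_add]; exact add_mem ha hb

theorem diffU_mem_pow (n : ℕ) {u : 𝔤.U} (hu : u ∈ 𝔤.augIdeal ^ n) :
    𝔤.diffU u ∈ 𝔤.augIdeal ^ n := by
  induction n generalizing u with
  | zero => rw [Submodule.pow_zero, Ideal.one_eq_top]; exact Submodule.mem_top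
  | succ n ih =>
    rw [Ideal.IsTwoSided.pow_succ] at hu ⊢
    induction hu using Submodule.smul_induction_on' with
    | smul a ha b hb =>
      rw [smul_eq_mul, diffU_mul]
      refine add_mem (Ideal.mul_mem_mul ?_ hb) (Ideal.mul_mem_mul ?_ (ih hb))
      · simp [RingHom.mem_ker, aug_diffU]
      · simpa [RingHom.mem_ker, aug_parityU] using ha
    | add a _ b _ ha hb => rw [map_add]; exact add_mem ha hb

/-- The quotient `U / Iⁿ` by a power of the augmentation ideal. -/
abbrev UQuot (n : ℕ) : Type _ := 𝔤.U ⧸ (𝔤.augIdeal ^ n)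

/-- The projection `U → U / Iⁿ`. -/
abbrev proj (n : ℕ) : 𝔤.U →ₐ[K] 𝔤.UQuot n := Ideal.Quotient.mkₐ K (𝔤.augIdeal ^ n)

/-- The complete universal enveloping algebra: the inverse limit of the algebras `U / Iⁿ`, with
`I` the augmentation ideal. Equivalently, it is the quotient of the complete tensor algebra
`∏ₙ L^{⊗n}` by the closed ideal generated by the relations `x y - (-1)^(|x||y|) y x - [x, y]`. -/
def completeU : Subalgebra K (∀ n : ℕ, 𝔤.UQuot n) where
  carrier := {s | ∀ n : ℕ,
    Ideal.Quotient.factorₐ K (Ideal.pow_le_pow_right (I := 𝔤.augIdeal) n.le_succ) (s (n + 1))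
      = s n}
  mul_mem' := fun {a b} ha hb n => by simp only [Pi.mul_apply, map_mul, ha n, hb n]
  add_mem' := fun {a b} ha hb n => by simp only [Pi.add_apply, map_add, ha n, hb n]
  algebraMap_mem' := fun r n => by simp

instance : Ring (∀ n : ℕ, 𝔤.UQuot n) := inferInstance
instance : Ring 𝔤.completeU := inferInstance

/-- The canonical map from the enveloping algebra to its completion. -/
def toComplete : 𝔤.U →ₐ[K] 𝔤.completeU :=
  (AlgHom.pi 𝔤.proj).codRestrict 𝔤.completeU (fun _ _ => rfl)

/-- The canonical map of a Lie algebra to its complete enveloping algebra. -/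
def ιc : L →ₗ[K] 𝔤.completeU := 𝔤.toComplete.toLinearMap ∘ₗ 𝔤.ι

/-- The parity operator of `U / Iⁿ`. -/
def parityQ (n : ℕ) : 𝔤.UQuot n →ₐ[K] 𝔤.UQuot n :=
  Ideal.Quotient.liftₐ (𝔤.augIdeal ^ n) ((𝔤.proj n).comp 𝔤.parityU) (fun u hu => by
    rw [AlgHom.comp_apply]
    exact Ideal.Quotient.eq_zero_iff_mem.2 (𝔤.parityU_mem_pow n hu))

/-- The algebra map `u ↦ !![parity u, d u; 0, u]` for `U / Iⁿ`. -/
def rhoQ (n : ℕ) : 𝔤.UQuot n →ₐ[K] Matrix (Fin 2) (Fin 2) (𝔤.UQuot n) :=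
  Ideal.Quotient.liftₐ (𝔤.augIdeal ^ n) ((𝔤.proj n).mapMatrix.comp 𝔤.rhoU) (fun u hu => by
    have h1 : 𝔤.proj n (𝔤.parityU u) = 0 :=
      Ideal.Quotient.eq_zero_iff_mem.2 (𝔤.parityU_mem_pow n hu)
    have h2 : 𝔤.proj n (𝔤.diffU u) = 0 :=
      Ideal.Quotient.eq_zero_iff_mem.2 (𝔤.diffU_mem_pow n hu)
    have h3 : 𝔤.proj n u = 0 := Ideal.Quotient.eq_zero_iff_mem.2 hu
    rw [AlgHom.comp_apply, 𝔤.rhoU_apply]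
    ext a b
    fin_cases a <;> fin_cases b
    · simpa using h1
    · simpa using h2
    · simp
    · simpa using h3)

/-- The derivation induced on `U / Iⁿ`. -/
def diffQ (n : ℕ) : 𝔤.UQuot n →ₗ[K] 𝔤.UQuot n where
  toFun u := 𝔤.rhoQ n u 0 1
  map_add' := by simp
  map_smul' := by simp

theorem parityQ_proj (n : ℕ) (u : 𝔤.U) :
    𝔤.parityQ n (𝔤.proj n u) = 𝔤.proj n (𝔤.parityU u) := rfl

theorem diffQ_proj (n : ℕ) (u : 𝔤.U) :
    𝔤.diffQ n (𝔤.proj n u) = 𝔤.proj n (𝔤.diffU u) := rfl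

theorem proj_surjective (n : ℕ) : Function.Surjective (𝔤.proj n) :=
  Ideal.Quotient.mkₐ_surjective K _

/-- The parity operator of the complete enveloping algebra. -/
def parityC : 𝔤.completeU →ₐ[K] 𝔤.completeU :=
  ((AlgHom.pi fun n => (𝔤.parityQ n).comp (Pi.evalAlgHom K _ n)).comp
    𝔤.completeU.val).codRestrict 𝔤.completeU (by
      rintro ⟨s, hs⟩ n
      change Ideal.Quotient.factorₐ K _ (𝔤.parityQ (n + 1) (s (n + 1))) = 𝔤.parityQ n (s n)
      rw [← hs n]
      obtain ⟨u, hu⟩ := 𝔤.proj_surjective (n + 1) (s (n + 1))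
      rw [← hu]
      rfl)

/-- The derivation of the complete enveloping algebra. -/
def diffC : 𝔤.completeU →ₗ[K] 𝔤.completeU where
  toFun s := ⟨fun n => 𝔤.diffQ n (s.1 n), by
    intro n
    change Ideal.Quotient.factorₐ K _ (𝔤.diffQ (n + 1) (s.1 (n + 1))) = 𝔤.diffQ n (s.1 n)
    rw [← s.2 n]
    obtain ⟨u, hu⟩ := 𝔤.proj_surjective (n + 1) (s.1 (n + 1))
    rw [← hu]
    rfl⟩
  map_add' x y := by ext n; simp
  map_smul' r x := by ext n; simp

/-- Products `x₁ ⋯ xₖ` of homogeneous elements of `L`, of total degree `p`. -/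
inductive IsHomogProd : ℤ → 𝔤.U → Prop
  | one : IsHomogProd 0 1
  | mul {p q : ℤ} {x : L} {u : 𝔤.U} (hx : x ∈ 𝔤.deg p) (hu : IsHomogProd q u) :
      IsHomogProd (p + q) (𝔤.ι x * u)

/-- The elements of degree `p` of the enveloping algebra. -/
def degU (p : ℤ) : Submodule K 𝔤.U := Submodule.span K {u | 𝔤.IsHomogProd p u}

/-- The elements of degree `p` of the complete enveloping algebra. -/
def degC (p : ℤ) : Submodule K 𝔤.completeU where
  carrier := {s | ∀ n : ℕ, s.1 n ∈ (𝔤.degU p).map (𝔤.proj n).toLinearMap}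
  add_mem' := fun ha hb n => add_mem (ha n) (hb n)
  zero_mem' := fun _ => zero_mem _
  smul_mem' := fun r _ ha n => Submodule.smul_mem _ r (ha n)

theorem IsHomogProd.mul' {p q : ℤ} {u v : 𝔤.U} (hu : 𝔤.IsHomogProd p u)
    (hv : 𝔤.IsHomogProd q v) : 𝔤.IsHomogProd (p + q) (u * v) := by
  induction hu with
  | one => simpa using hv
  | mul hx _ ih => rw [mul_assoc, add_assoc]; exact .mul hx ih

theorem mul_mem_degU {p q : ℤ} {u v : 𝔤.U} (hu : u ∈ 𝔤.degU p) (hv : v ∈ 𝔤.degU q) :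
    u * v ∈ 𝔤.degU (p + q) := by
  induction hu using Submodule.span_induction with
  | mem u hu =>
    induction hv using Submodule.span_induction with
    | mem v hv => exact Submodule.subset_span (hu.mul' 𝔤 hv)
    | zero => simp
    | add a b _ _ ha hb => rw [mul_add]; exact add_mem ha hb
    | smul r a _ ha => rw [mul_smul_comm]; exact Submodule.smul_mem _ _ ha
  | zero => simp
  | add a b _ _ ha hb => rw [add_mul]; exact add_mem ha hb
  | smul r a _ ha => rw [smul_mul_assoc]; exact Submodule.smul_mem _ _ ha

theorem ι_mem_degU {p : ℤ} {x : L} (hx : x ∈ 𝔤.deg p) : 𝔤.ι x ∈ 𝔤.degU p := by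
  have h := IsHomogProd.mul hx (IsHomogProd.one (𝔤 := 𝔤))
  rw [mul_one, add_zero] at h
  exact Submodule.subset_span h

theorem parityU_of_mem {p : ℤ} {u : 𝔤.U} (hu : u ∈ 𝔤.degU p) :
    𝔤.parityU u = (-1 : K) ^ p • u := by
  induction hu using Submodule.span_induction with
  | mem u hu =>
    induction hu with
    | one => simp
    | mul hx _ ih =>
      rw [map_mul, parityU_ι, 𝔤.parity_apply hx, ih, map_smul, smul_mul_smul_comm,
        zpow_add₀ (by simp)]
  | zero => simp
  | add a b _ _ ha hb => rw [map_add, ha, hb, smul_add]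
  | smul r a _ ha => rw [map_smul, ha, smul_comm]

theorem diffU_mem_degU {p : ℤ} {u : 𝔤.U} (hu : u ∈ 𝔤.degU p) : 𝔤.diffU u ∈ 𝔤.degU (p - 1) := by
  induction hu using Submodule.span_induction with
  | mem u hu =>
    induction hu with
    | one => rw [← map_one (algebraMap K 𝔤.U), diffU_algebraMap]; exact zero_mem _
    | @mul p q x u hx hu ih =>
      rw [diffU_mul, diffU_ι, parityU_ι, 𝔤.parity_apply hx, map_smul, smul_mul_assoc]
      refine add_mem ?_ (Submodule.smul_mem _ _ ?_)
      · have := 𝔤.mul_mem_degU (𝔤.ι_mem_degU (𝔤.diff_mem hx)) (Submodule.subset_span hu)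
        rwa [show p - 1 + q = p + q - 1 by ring] at this
      · have := 𝔤.mul_mem_degU (𝔤.ι_mem_degU hx) ih
        rwa [show p + (q - 1) = p + q - 1 by ring] at this
  | zero => simp
  | add a b _ _ ha hb => rw [map_add]; exact add_mem ha hb
  | smul r a _ ha => rw [map_smul]; exact Submodule.smul_mem _ _ ha

/-- The complete universal enveloping algebra with its degrees and derivation. -/
def envelope : PreDGA K 𝔤.completeU where
  deg := 𝔤.degC
  parity := 𝔤.parityC
  diff := 𝔤.diffC
  one_mem := fun n => ⟨1, Submodule.subset_span .one, by simp⟩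
  mul_mem := by
    intro p q x y hx hy n
    obtain ⟨u, hu, hu'⟩ := hx n
    obtain ⟨v, hv, hv'⟩ := hy n
    refine ⟨u * v, 𝔤.mul_mem_degU hu hv, ?_⟩
    change _ = x.1 n * y.1 n
    rw [← hu', ← hv']
    simp
  parity_apply := by
    intro p x hx
    ext n
    obtain ⟨u, hu, hu'⟩ := hx n
    change 𝔤.parityQ n (x.1 n) = (-1 : K) ^ p • x.1 n
    rw [← hu']
    change 𝔤.proj n (𝔤.parityU u) = (-1 : K) ^ p • 𝔤.proj n u
    rw [𝔤.parityU_of_mem hu, map_smul]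
  parity_parity := by
    intro x
    ext n
    obtain ⟨u, hu⟩ := 𝔤.proj_surjective n (x.1 n)
    change 𝔤.parityQ n (𝔤.parityQ n (x.1 n)) = x.1 n
    rw [← hu, parityQ_proj, parityQ_proj, parityU_parityU]
  diff_mem := by
    intro p x hx n
    obtain ⟨u, hu, hu'⟩ := hx n
    refine ⟨𝔤.diffU u, 𝔤.diffU_mem_degU hu, ?_⟩
    change _ = 𝔤.diffQ n (x.1 n)
    rw [← hu']
    rfl
  parity_diff := by
    intro x
    ext n
    obtain ⟨u, hu⟩ := 𝔤.proj_surjective n (x.1 n)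
    change 𝔤.parityQ n (𝔤.diffQ n (x.1 n)) = -𝔤.diffQ n (𝔤.parityQ n (x.1 n))
    rw [← hu, parityQ_proj, diffQ_proj, parityQ_proj, diffQ_proj, parityU_diffU, map_neg]
  leibniz := by
    intro x y
    ext n
    obtain ⟨u, hu⟩ := 𝔤.proj_surjective n (x.1 n)
    obtain ⟨v, hv⟩ := 𝔤.proj_surjective n (y.1 n)
    change 𝔤.diffQ n (x.1 n * y.1 n)
      = 𝔤.diffQ n (x.1 n) * y.1 n + 𝔤.parityQ n (x.1 n) * 𝔤.diffQ n (y.1 n)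
    rw [← hu, ← hv, ← map_mul, parityQ_proj, diffQ_proj, diffQ_proj, diffQ_proj, diffU_mul]
    simp

end PreDGL

/-! ### Complete tensor algebras and complete free Lie algebras -/

/-- The complete tensor algebra `∏ₙ Tⁿ(V)` of the vector space `V` with finite basis `X`: since
words of length `n` in `X` form a basis of `Tⁿ(V)`, its elements are the formal series
`∑ f(w) w` over all words `w`. -/
structure Series (K X : Type*) where
  coeff : List X → K

namespace Series

instance {K X : Type*} : CoeFun (Series K X) fun _ => List X → K := ⟨coeff⟩

@[ext] theorem ext' {K X : Type*} {f g : Series K X} (h : ∀ w, f w = g w) : f = g := by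
  cases f; cases g; congr; exact funext h

/-- A series is the same as its family of coefficients. -/
def coeffEquiv (K X : Type*) : Series K X ≃ (List X → K) := ⟨coeff, mk, fun _ => rfl, fun _ => rfl⟩

variable {K X : Type*} [Field K]

instance : AddCommGroup (Series K X) := (coeffEquiv K X).addCommGroup
instance : Module K (Series K X) := (coeffEquiv K X).module K

@[simp] theorem add_apply (f g : Series K X) (w : List X) : (f + g) w = f w + g w := rfl
@[simp] theorem neg_apply (f : Series K X) (w : List X) : (-f) w = -f w := rfl
@[simp] theorem sub_apply (f g : Series K X) (w : List X) : (f - g) w = f w - g w := rfl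
@[simp] theorem zero_apply (w : List X) : (0 : Series K X) w = 0 := rfl
@[simp] theorem smul_apply (r : K) (f : Series K X) (w : List X) : (r • f) w = r * f w := rfl

theorem sum_apply {α : Type*} (s : Finset α) (f : α → Series K X) (w : List X) :
    (∑ a ∈ s, f a) w = ∑ a ∈ s, f a w :=
  map_sum (⟨⟨fun f => f w, rfl⟩, fun _ _ => rfl⟩ : Series K X →+ K) f s

/-- The product which extends the concatenation of words. -/
instance : Mul (Series K X) :=
  ⟨fun f g => ⟨fun w => ∑ i ∈ range (w.length + 1), f (w.take i) * g (w.drop i)⟩⟩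

instance : One (Series K X) := ⟨⟨fun w => if w.length = 0 then 1 else 0⟩⟩

theorem mul_apply (f g : Series K X) (w : List X) :
    (f * g) w = ∑ i ∈ range (w.length + 1), f (w.take i) * g (w.drop i) := rfl

theorem one_apply (w : List X) : (1 : Series K X) w = if w.length = 0 then 1 else 0 := rfl

/-- The coefficients of the words beginning with `x`. -/
def shift (x : X) : Series K X →ₗ[K] Series K X where
  toFun f := ⟨fun w => f (x :: w)⟩
  map_add' _ _ := rfl
  map_smul' _ _ := rfl

@[simp] theorem shift_apply (x : X) (f : Series K X) (w : List X) : shift x f w = f (x :: w) := rfl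

@[simp] theorem mul_nil (f g : Series K X) : (f * g) [] = f [] * g [] := by simp [mul_apply]

theorem mul_cons (f g : Series K X) (x : X) (w : List X) :
    (f * g) (x :: w) = f [] * g (x :: w) + (shift x f * g) w := by
  rw [mul_apply, List.length_cons, sum_range_succ']
  simp [mul_apply, add_comm]

theorem add_mul' (f g h : Series K X) : (f + g) * h = f * h + g * h := by
  ext w; simp [mul_apply, add_mul, sum_add_distrib]

theorem mul_add' (f g h : Series K X) : f * (g + h) = f * g + f * h := by
  ext w; simp [mul_apply, mul_add, sum_add_distrib]

theorem smul_mul' (r : K) (f g : Series K X) : (r • f) * g = r • (f * g) := by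
  ext w; simp [mul_apply, mul_sum, mul_assoc]

theorem mul_smul' (r : K) (f g : Series K X) : f * (r • g) = r • (f * g) := by
  ext w; simp [mul_apply, mul_sum, mul_left_comm]

theorem shift_mul (f g : Series K X) (x : X) :
    shift x (f * g) = f [] • shift x g + shift x f * g := by
  ext w; simp [mul_cons]

theorem mul_assoc' (f g h : Series K X) : f * g * h = f * (g * h) := by
  ext w
  induction w generalizing f g h with
  | nil => simp [mul_assoc]
  | cons x w ih =>
    rw [mul_cons, mul_cons, shift_mul, add_mul', smul_mul', mul_cons g h]
    simp only [mul_nil, add_apply, smul_apply, ih]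
    ring

theorem one_mul' (f : Series K X) : 1 * f = f := by
  ext w
  cases w with
  | nil => simp [one_apply]
  | cons x w =>
    have : shift x (1 : Series K X) = 0 := by ext w; simp [one_apply]
    rw [mul_cons, this, one_apply]
    simp [mul_apply]

theorem mul_one' (f : Series K X) : f * 1 = f := by
  ext w
  induction w generalizing f with
  | nil => simp [one_apply]
  | cons x w ih =>
    rw [mul_cons, ih, one_apply]
    simp

instance : Ring (Series K X) where
  __ := (inferInstance : AddCommGroup (Series K X))
  mul_assoc := mul_assoc'
  one_mul := one_mul'
  mul_one := mul_one'
  left_distrib := mul_add'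
  right_distrib := add_mul'
  zero_mul f := by ext w; simp [mul_apply]
  mul_zero f := by ext w; simp [mul_apply]

instance : Algebra K (Series K X) := Algebra.ofModule smul_mul' mul_smul'

open Classical in
/-- The generator `x ∈ V`. -/
def gen (x : X) : Series K X := ⟨fun w => if w = [x] then 1 else 0⟩

/-- The sum of a sequence of series such that `t n` only involves words of length at least `n`. -/
def formalSum (t : ℕ → Series K X) : Series K X :=
  ⟨fun w => ∑ n ∈ range (w.length + 1), t n w⟩

/-- The component in `Tⁿ(V)`. -/
def comp (n : ℕ) : Series K X →ₗ[K] Series K X where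
  toFun f := ⟨fun w => if w.length = n then f w else 0⟩
  map_add' f g := by ext w; by_cases h : w.length = n <;> simp [h]
  map_smul' r f := by ext w; by_cases h : w.length = n <;> simp [h]

theorem comp_apply (n : ℕ) (f : Series K X) (w : List X) :
    comp n f w = if w.length = n then f w else 0 := rfl

section graded

variable (d : X → ℤ)

/-- The degree of a word, when the generator `x` has degree `d x`. -/
def wordDeg (w : List X) : ℤ := (w.map d).sum

@[simp] theorem wordDeg_nil : wordDeg d [] = 0 := rfl
@[simp] theorem wordDeg_cons (x : X) (w : List X) : wordDeg d (x :: w) = d x + wordDeg d w := by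
  simp [wordDeg]
@[simp] theorem wordDeg_append (v w : List X) :
    wordDeg d (v ++ w) = wordDeg d v + wordDeg d w := by
  simp [wordDeg]

/-- The series of degree `p`. -/
def degPart (p : ℤ) : Submodule K (Series K X) where
  carrier := {f | ∀ w, wordDeg d w ≠ p → f w = 0}
  add_mem' hf hg w hw := by simp [hf w hw, hg w hw]
  zero_mem' _ _ := rfl
  smul_mem' r f hf w hw := by simp [hf w hw]

/-- The parity operator, `w ↦ (-1)^|w| w` on words. -/
def parity : Series K X →ₐ[K] Series K X :=
  AlgHom.ofLinearMap
    { toFun := fun f => ⟨fun w => (-1 : K) ^ wordDeg d w * f w⟩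
      map_add' := fun f g => by ext w; simp [mul_add]
      map_smul' := fun r f => by ext w; simp [mul_left_comm] }
    (by
      ext w
      change (-1 : K) ^ wordDeg d w * (1 : Series K X) w = (1 : Series K X) w
      cases w <;> simp [one_apply])
    (fun f g => by
      ext w
      change (-1 : K) ^ wordDeg d w * (f * g) w = _
      rw [mul_apply, mul_apply, mul_sum]
      refine sum_congr rfl fun i _ => ?_
      change _ = (-1 : K) ^ wordDeg d (w.take i) * f (w.take i)
        * ((-1 : K) ^ wordDeg d (w.drop i) * g (w.drop i))
      conv_lhs => rw [← List.take_append_drop i w, wordDeg_append, zpow_add₀ (by simp)]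
      rw [List.take_append_drop]
      ring)

theorem parity_apply (f : Series K X) (w : List X) :
    parity d f w = (-1 : K) ^ wordDeg d w * f w := rfl

theorem parity_parity (f : Series K X) : parity d (parity d f) = f := by
  ext w
  rw [parity_apply, parity_apply]
  rcases neg_one_zpow_cases (K := K) (wordDeg d w) with h | h <;> simp [h.2]

theorem parity_of_mem {p : ℤ} {f : Series K X} (hf : f ∈ degPart d p) :
    parity d f = (-1 : K) ^ p • f := by
  ext w
  rw [parity_apply, smul_apply]
  by_cases h : wordDeg d w = p
  · rw [h]
  · simp [hf w h]

theorem one_mem_degPart : (1 : Series K X) ∈ degPart d 0 := by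
  intro w hw
  cases w with
  | nil => simp at hw
  | cons x w => simp [one_apply]

theorem mul_mem_degPart {p q : ℤ} {f g : Series K X} (hf : f ∈ degPart d p)
    (hg : g ∈ degPart d q) : f * g ∈ degPart d (p + q) := by
  intro w hw
  rw [mul_apply]
  refine sum_eq_zero fun i _ => ?_
  by_cases h : wordDeg d (w.take i) = p
  · rw [hg (w.drop i), mul_zero]
    rintro rfl
    apply hw
    rw [← h, ← wordDeg_append, List.take_append_drop]
  · rw [hf _ h, zero_mul]

theorem gen_mem_degPart (x : X) : (gen x : Series K X) ∈ degPart d (d x) := by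
  intro w hw
  refine if_neg ?_
  rintro rfl
  simp at hw

theorem formalSum_mem_degPart {p : ℤ} {t : ℕ → Series K X} (ht : ∀ n, t n ∈ degPart d p) :
    formalSum t ∈ degPart d p := fun w hw =>
  Finset.sum_eq_zero (s := range (w.length + 1)) fun n _ => ht n w hw

theorem parity_gen (x : X) : parity d (gen x : Series K X) = (-1 : K) ^ d x • gen x :=
  parity_of_mem d (gen_mem_degPart d x)

/-- The continuous derivation of the complete tensor algebra with value `c x` at the generator
`x`: on words, `x₁ ⋯ xₙ ↦ ∑ᵢ (-1)^(|x₁| + ⋯ + |xᵢ₋₁|) x₁ ⋯ xᵢ₋₁ (c xᵢ) xᵢ₊₁ ⋯ xₙ`. The formula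
below gives the coefficient of `w` in the image of a series, and runs over the ways to write
`w = u v u'` with `v` occurring in `c x`. -/
def deriv [Fintype X] (c : X → Series K X) : Series K X →ₗ[K] Series K X where
  toFun f := ⟨fun w => ∑ i ∈ range (w.length + 1), ∑ j ∈ range (w.length - i + 1), ∑ x : X,
    (-1 : K) ^ wordDeg d (w.take i) * c x ((w.drop i).take j)
      * f (w.take i ++ x :: (w.drop i).drop j)⟩
  map_add' f g := by ext w; simp [mul_add, sum_add_distrib]
  map_smul' r f := by ext w; simp [mul_left_comm, mul_sum]

section deriv

variable (c : X → Series K X)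

theorem deriv_apply [Fintype X] (f : Series K X) (w : List X) :
    deriv d c f w = ∑ i ∈ range (w.length + 1), ∑ j ∈ range (w.length - i + 1), ∑ x : X,
      (-1 : K) ^ wordDeg d (w.take i) * c x ((w.drop i).take j)
        * f (w.take i ++ x :: (w.drop i).drop j) := rfl

theorem deriv_nil [Fintype X] (f : Series K X) : deriv d c f [] = (∑ x, c x * shift x f) [] := by
  simp [deriv_apply, sum_apply]

theorem deriv_cons [Fintype X] (f : Series K X) (y : X) (w : List X) :
    deriv d c f (y :: w) = (∑ x, c x * shift x f) (y :: w)
      + (-1 : K) ^ d y * deriv d c (shift y f) w := by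
  rw [deriv_apply, List.length_cons, sum_range_succ', add_comm]
  congr 1
  · rw [sum_comm, sum_apply]
    refine sum_congr rfl fun x _ => ?_
    simp [mul_apply]
  · rw [deriv_apply, mul_sum]
    refine sum_congr rfl fun i _ => ?_
    simp only [mul_sum, Nat.add_sub_add_right]
    refine sum_congr rfl fun j _ => sum_congr rfl fun x _ => ?_
    simp only [List.take_succ_cons, wordDeg_cons, List.drop_succ_cons, List.cons_append,
      shift_apply]
    rw [zpow_add₀ (by simp)]
    ring

theorem shift_parity (f : Series K X) (y : X) :
    shift y (parity d f) = (-1 : K) ^ d y • parity d (shift y f) := by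
  ext w
  simp only [shift_apply, parity_apply, wordDeg_cons, smul_apply]
  rw [zpow_add₀ (by simp)]
  ring

theorem deriv_gen [Fintype X] (x : X) : deriv d c (gen x) = c x := by
  classical
  have h : ∀ y, shift y (gen x : Series K X) = if y = x then 1 else 0 := by
    intro y
    ext w
    by_cases hy : y = x <;> cases w <;> simp [gen, hy, one_apply]
  have hone : deriv d c (1 : Series K X) = 0 := by
    ext w
    simp [deriv_apply, one_apply]
  ext w
  have hs : (∑ y, c y * shift y (gen x : Series K X)) = c x := by simp [h]
  cases w with
  | nil => rw [deriv_nil, hs]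
  | cons y w =>
    rw [deriv_cons, hs, h]
    split_ifs <;> simp [hone]

theorem deriv_mul [Fintype X] (f g : Series K X) :
    deriv d c (f * g) = deriv d c f * g + parity d f * deriv d c g := by
  have key : ∀ f g : Series K X, (∑ x, c x * shift x (f * g))
      = f [] • (∑ x, c x * shift x g) + (∑ x, c x * shift x f) * g := by
    intro f g
    simp only [shift_mul, mul_add, sum_add_distrib, sum_mul, smul_sum, mul_smul_comm, mul_assoc]
  ext w
  induction w generalizing f g with
  | nil =>
    rw [deriv_nil, key, add_apply, add_apply, mul_nil, mul_nil, mul_nil, deriv_nil, deriv_nil,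
      parity_apply, smul_apply]
    simp only [wordDeg_nil, zpow_zero]
    ring
  | cons y w ih =>
    have hs : shift y (deriv d c f) = shift y (∑ x, c x * shift x f)
        + (-1 : K) ^ d y • deriv d c (shift y f) := by
      ext w
      rw [shift_apply, deriv_cons, add_apply, shift_apply, smul_apply]
    rw [deriv_cons, key, add_apply, add_apply, mul_cons (deriv d c f), mul_cons (parity d f),
      deriv_nil, deriv_cons, shift_mul, map_add, add_apply (deriv _ _ _), ih, hs, shift_parity,
      add_apply, add_mul,
      mul_cons (∑ x, c x * shift x f), map_smul, smul_mul_assoc, smul_mul_assoc, parity_apply]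
    simp
    ring

variable {c}

theorem deriv_mem_degPart [Fintype X] (hc : ∀ x, c x ∈ degPart d (d x - 1)) {p : ℤ} {f : Series K X}
    (hf : f ∈ degPart d p) : deriv d c f ∈ degPart d (p - 1) := by
  intro w hw
  rw [deriv_apply]
  refine sum_eq_zero fun i _ => sum_eq_zero fun j _ => sum_eq_zero fun x _ => ?_
  by_cases h : wordDeg d ((w.drop i).take j) = d x - 1
  · rw [hf, mul_zero]
    intro h'
    apply hw
    rw [← h']
    conv_lhs => rw [← List.take_append_drop i w, ← List.take_append_drop j (w.drop i)]
    simp only [wordDeg_append, wordDeg_cons, h]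
    ring
  · rw [hc x _ h]; ring

theorem parity_deriv [Fintype X] (hc : ∀ x, c x ∈ degPart d (d x - 1)) (f : Series K X) :
    parity d (deriv d c f) = -deriv d c (parity d f) := by
  ext w
  rw [parity_apply, neg_apply, deriv_apply, deriv_apply, mul_sum, ← sum_neg_distrib]
  refine sum_congr rfl fun i _ => ?_
  rw [mul_sum, ← sum_neg_distrib]
  refine sum_congr rfl fun j _ => ?_
  rw [mul_sum, ← sum_neg_distrib]
  refine sum_congr rfl fun x _ => ?_
  by_cases h : wordDeg d ((w.drop i).take j) = d x - 1
  · have hw : wordDeg d w = wordDeg d (w.take i ++ x :: (w.drop i).drop j) - 1 := by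
      conv_lhs => rw [← List.take_append_drop i w, ← List.take_append_drop j (w.drop i)]
      simp only [wordDeg_append, wordDeg_cons, h]
      ring
    rw [parity_apply, hw, zpow_sub₀ (by simp)]
    simp
    ring
  · rw [hc x _ h]; ring

end deriv

/-- The graded commutator `[f, g] = f g - (-1)^(|f||g|) g f`, extended bilinearly to series; with
`f = f₀ + f₁` the even and odd parts of `f`, it is `f g - g f₀ - (parity g) f₁`. -/
def bracket : Series K X →ₗ[K] Series K X →ₗ[K] Series K X :=
  LinearMap.mk₂ K
    (fun f g => f * g - g * ((2 : K)⁻¹ • (f + parity d f))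
      - parity d g * ((2 : K)⁻¹ • (f - parity d f)))
    (fun f f' g => by simp only [map_add, mul_smul_comm, mul_add, add_mul, mul_sub]; module)
    (fun r f g => by
      simp only [map_smul, mul_smul_comm, smul_mul_assoc, mul_add, mul_sub]; module)
    (fun f g g' => by
      simp only [map_add, mul_smul_comm, mul_add, add_mul, mul_sub]; module)
    (fun r f g => by
      simp only [map_smul, mul_smul_comm, smul_mul_assoc, mul_add, mul_sub]; module)

theorem bracket_apply (f g : Series K X) :
    bracket d f g = f * g - g * ((2 : K)⁻¹ • (f + parity d f))
      - parity d g * ((2 : K)⁻¹ • (f - parity d f)) := rfl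

theorem bracket_even [CharZero K] {f : Series K X} (hf : parity d f = f) (g : Series K X) :
    bracket d f g = f * g - g * f := by
  rw [bracket_apply, hf, ← two_smul K f, smul_smul, inv_mul_cancel₀ two_ne_zero]
  simp

theorem bracket_odd [CharZero K] {f : Series K X} (hf : parity d f = -f) (g : Series K X) :
    bracket d f g = f * g - parity d g * f := by
  rw [bracket_apply, hf, sub_neg_eq_add, ← two_smul K f, smul_smul, inv_mul_cancel₀ two_ne_zero]
  simp

theorem parity_cases {i : ℤ} {f : Series K X} (hf : parity d f = (-1 : K) ^ i • f) :
    (Even i ∧ (-1 : K) ^ i = 1 ∧ parity d f = f) ∨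
      (Odd i ∧ (-1 : K) ^ i = -1 ∧ parity d f = -f) := by
  rcases neg_one_zpow_cases (K := K) i with ⟨h, h'⟩ | ⟨h, h'⟩
  · exact Or.inl ⟨h, h', by rw [hf, h', one_smul]⟩
  · exact Or.inr ⟨h, h', by rw [hf, h', neg_one_smul]⟩

/-- On even and odd elements, the bracket is the graded commutator. -/
theorem bracket_of_parity [CharZero K] {i j : ℤ} {f g : Series K X} (hf : parity d f = (-1 : K) ^ i • f)
    (hg : parity d g = (-1 : K) ^ j • g) :
    bracket d f g = f * g - (-1 : K) ^ (i * j) • (g * f) := by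
  rcases parity_cases d hf with ⟨hi, -, hf⟩ | ⟨hi, -, hf⟩
  · rw [bracket_even d hf, (hi.mul_right j).neg_one_zpow, one_smul]
  · rw [bracket_odd d hf]
    rcases parity_cases d hg with ⟨hj, -, hg⟩ | ⟨hj, -, hg⟩
    · rw [hg, (hj.mul_left i).neg_one_zpow, one_smul]
    · rw [hg, (hi.mul hj).neg_one_zpow, neg_mul, neg_one_smul]

theorem parity_bracket (f g : Series K X) :
    parity d (bracket d f g) = bracket d (parity d f) (parity d g) := by
  simp only [bracket_apply, map_sub, map_mul, map_smul, map_add]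

theorem bracket_antisymm [CharZero K] {i j : ℤ} {f g : Series K X} (hf : parity d f = (-1 : K) ^ i • f)
    (hg : parity d g = (-1 : K) ^ j • g) :
    bracket d f g = -((-1 : K) ^ (i * j) • bracket d g f) := by
  rw [bracket_of_parity d hf hg, bracket_of_parity d hg hf, mul_comm j i, smul_sub, smul_smul]
  rcases neg_one_zpow_cases (K := K) (i * j) with h | h <;> simp [h.2]

theorem bracket_jacobi [CharZero K] {i j : ℤ} {f g : Series K X} (h : Series K X)
    (hf : parity d f = (-1 : K) ^ i • f) (hg : parity d g = (-1 : K) ^ j • g) :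
    bracket d f (bracket d g h) = bracket d (bracket d f g) h
      + (-1 : K) ^ (i * j) • bracket d g (bracket d f h) := by
  have hfg := parity_bracket d f g
  rcases parity_cases d hf with ⟨hi, -, hf⟩ | ⟨hi, -, hf⟩ <;>
  rcases parity_cases d hg with ⟨hj, -, hg⟩ | ⟨hj, -, hg⟩
  · rw [hf, hg] at hfg
    rw [(hi.mul_right j).neg_one_zpow, bracket_even d hfg]
    simp only [bracket_even d hf, bracket_even d hg]
    rw [one_smul]; noncomm_ring
  · rw [hf, hg, map_neg] at hfg
    rw [(hi.mul_right j).neg_one_zpow, bracket_odd d hfg]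
    simp only [bracket_even d hf, bracket_odd d hg, map_sub, map_mul, hf]
    rw [one_smul]; noncomm_ring
  · rw [hf, hg, map_neg, LinearMap.neg_apply] at hfg
    rw [(hj.mul_left i).neg_one_zpow, bracket_odd d hfg]
    simp only [bracket_even d hg, bracket_odd d hf, map_sub, map_mul, hg]
    rw [one_smul]; noncomm_ring
  · rw [hf, hg, map_neg, map_neg, LinearMap.neg_apply, neg_neg] at hfg
    rw [(hi.mul hj).neg_one_zpow, bracket_even d hfg]
    simp only [bracket_odd d hg, bracket_odd d hf, map_sub, map_mul, hf, hg, parity_parity]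
    rw [neg_one_smul]; noncomm_ring

theorem bracket_mem_degPart [CharZero K] {p q : ℤ} {f g : Series K X} (hf : f ∈ degPart d p)
    (hg : g ∈ degPart d q) : bracket d f g ∈ degPart d (p + q) := by
  rw [bracket_of_parity d (parity_of_mem d hf) (parity_of_mem d hg)]
  refine sub_mem (mul_mem_degPart d hf hg) (Submodule.smul_mem _ _ ?_)
  rw [add_comm]
  exact mul_mem_degPart d hg hf

theorem deriv_bracket [Fintype X] {c : X → Series K X} (hc : ∀ x, c x ∈ degPart d (d x - 1))
    (f g : Series K X) : deriv d c (bracket d f g)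
      = bracket d (deriv d c f) g + bracket d (parity d f) (deriv d c g) := by
  have hp : ∀ f, deriv d c (parity d f) = -parity d (deriv d c f) := fun f => by
    rw [parity_deriv d hc, neg_neg]
  simp only [bracket_apply, map_sub, deriv_mul, map_smul, map_add, hp, parity_parity,
    mul_smul_comm, mul_add, mul_sub]
  simp only [neg_mul, mul_neg]
  module

/-- The free Lie algebra `𝕃(V)`: the Lie subalgebra generated by `V`. -/
def freeLie : Submodule K (Series K X) :=
  sInf {S | (∀ x, gen x ∈ S) ∧ ∀ f ∈ S, ∀ g ∈ S, bracket d f g ∈ S}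

/-- The complete free Lie algebra on `V`: the series `∑ₙ fₙ` with `fₙ ∈ 𝕃(V) ∩ Tⁿ(V)`. -/
def completeLie : Submodule K (Series K X) where
  carrier := {f | ∀ n, comp n f ∈ freeLie d}
  add_mem' hf hg n := by rw [map_add]; exact add_mem (hf n) (hg n)
  zero_mem' n := by rw [map_zero]; exact zero_mem _
  smul_mem' r f hf n := by rw [map_smul]; exact Submodule.smul_mem _ _ (hf n)

theorem gen_mem_freeLie (x : X) : (gen x : Series K X) ∈ freeLie d :=
  Submodule.mem_sInf.2 fun _ hS => hS.1 x

theorem bracket_mem_freeLie {f g : Series K X} (hf : f ∈ freeLie d) (hg : g ∈ freeLie d) :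
    bracket d f g ∈ freeLie d :=
  Submodule.mem_sInf.2 fun S hS =>
    hS.2 f (Submodule.mem_sInf.1 hf S hS) g (Submodule.mem_sInf.1 hg S hS)

theorem freeLie_le {S : Submodule K (Series K X)} (h1 : ∀ x, gen x ∈ S)
    (h2 : ∀ f ∈ S, ∀ g ∈ S, bracket d f g ∈ S) : freeLie d ≤ S := sInf_le ⟨h1, h2⟩

theorem comp_mul (n : ℕ) (f g : Series K X) :
    comp n (f * g) = ∑ a ∈ antidiagonal n, comp a.1 f * comp a.2 g := by
  ext w
  rw [comp_apply, sum_apply]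
  simp only [mul_apply, comp_apply]
  split_ifs with h
  · subst h
    rw [sum_comm]
    refine sum_congr rfl fun i hi => ?_
    have hi : i ≤ w.length := Nat.lt_succ_iff.1 (mem_range.1 hi)
    rw [sum_eq_single (i, w.length - i)]
    · simp [hi]
    · rintro ⟨p, q⟩ hpq hne
      have hpq : p + q = w.length := HasAntidiagonal.mem_antidiagonal.1 hpq
      rw [if_neg, zero_mul]
      rw [List.length_take, min_eq_left hi]
      rintro rfl
      apply hne
      rw [← hpq]
      simp
    · intro hn
      exact absurd (HasAntidiagonal.mem_antidiagonal.2 (by simp; omega)) hn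
  · symm
    refine sum_eq_zero fun a ha => sum_eq_zero fun i hi => ?_
    have ha := HasAntidiagonal.mem_antidiagonal.1 ha
    by_cases h1 : (w.take i).length = a.1
    · rw [if_neg (c := (w.drop i).length = a.2), mul_zero]
      intro h2
      apply h
      rw [← ha, ← h1, ← h2, ← List.length_append, List.take_append_drop]
    · rw [if_neg h1, zero_mul]

theorem comp_parity (n : ℕ) (f : Series K X) : comp n (parity d f) = parity d (comp n f) := by
  ext w
  simp only [comp_apply, parity_apply]
  split_ifs <;> simp

theorem comp_bracket (n : ℕ) (f g : Series K X) :
    comp n (bracket d f g) = ∑ a ∈ antidiagonal n, bracket d (comp a.1 f) (comp a.2 g) := by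
  have hswap : ∀ f g : Series K X,
      comp n (f * g) = ∑ a ∈ antidiagonal n, comp a.2 f * comp a.1 g := fun f g => by
    rw [comp_mul, ← Nat.sum_antidiagonal_swap]
    rfl
  simp only [bracket_apply]
  rw [map_sub, map_sub, comp_mul, hswap, hswap, sum_sub_distrib, sum_sub_distrib]
  simp only [map_sub, map_add, map_smul, comp_parity]

theorem bracket_mem_completeLie {f g : Series K X} (hf : f ∈ completeLie d)
    (hg : g ∈ completeLie d) : bracket d f g ∈ completeLie d := fun n => by
  rw [comp_bracket]
  exact sum_mem fun a _ => bracket_mem_freeLie d (hf _) (hg _)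

theorem gen_mem_completeLie (x : X) : (gen x : Series K X) ∈ completeLie d := fun n => by
  by_cases h : n = 1
  · have : comp n (gen x : Series K X) = gen x := by
      ext w; rw [comp_apply, gen]
      by_cases hw : w = [x]
      · simp [hw, h]
      · simp [hw]
    rw [this]; exact gen_mem_freeLie d x
  · have : comp n (gen x : Series K X) = 0 := by
      ext w; rw [comp_apply, gen]
      by_cases hw : w = [x]
      · simp [hw, Ne.symm h]
      · simp [hw]
    rw [this]; exact zero_mem _

theorem formalSum_mem_completeLie {t : ℕ → Series K X} (ht : ∀ n, t n ∈ completeLie d) :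
    formalSum t ∈ completeLie d := fun n => by
  have : comp n (formalSum t) = ∑ k ∈ range (n + 1), comp n (t k) := by
    ext w
    simp only [sum_apply, comp_apply, formalSum]
    split_ifs with h
    · rw [h]
    · simp
  rw [this]
  exact sum_mem fun k _ => ht k n

theorem freeLie_le_completeLie : (freeLie d : Submodule K (Series K X)) ≤ completeLie d :=
  freeLie_le d (gen_mem_completeLie d) fun _ hf _ hg => bracket_mem_completeLie d hf hg

theorem parity_mem_freeLie {f : Series K X} (hf : f ∈ freeLie d) : parity d f ∈ freeLie d := by
  refine freeLie_le (S := (freeLie d).comap (parity d).toLinearMap) d (fun x => ?_)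
    (fun f hf g hg => ?_) hf
  · rw [Submodule.mem_comap, AlgHom.toLinearMap_apply, parity_gen]
    exact Submodule.smul_mem _ _ (gen_mem_freeLie d x)
  · rw [Submodule.mem_comap, AlgHom.toLinearMap_apply, parity_bracket]
    exact bracket_mem_freeLie d hf hg

theorem parity_mem_completeLie {f : Series K X} (hf : f ∈ completeLie d) :
    parity d f ∈ completeLie d := fun n => by
  rw [comp_parity]; exact parity_mem_freeLie d (hf n)

section derivLie

variable {c : X → Series K X}

theorem deriv_mem_of_freeLie [Fintype X] (hc : ∀ x, c x ∈ degPart d (d x - 1))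
    (hL : ∀ x, c x ∈ completeLie d) {f : Series K X} (hf : f ∈ freeLie d) :
    deriv d c f ∈ completeLie d := by
  have h : (freeLie d : Submodule K (Series K X))
      ≤ completeLie d ⊓ (completeLie d).comap (deriv d c) := by
    refine freeLie_le d (fun x => ⟨gen_mem_completeLie d x, ?_⟩) (fun f hf g hg => ⟨?_, ?_⟩)
    · rw [SetLike.mem_coe, Submodule.mem_comap, deriv_gen]; exact hL x
    · exact bracket_mem_completeLie d hf.1 hg.1
    · rw [SetLike.mem_coe, Submodule.mem_comap, deriv_bracket d hc]
      exact add_mem (bracket_mem_completeLie d hf.2 hg.1)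
        (bracket_mem_completeLie d (parity_mem_completeLie d hf.1) hg.2)
  exact (h hf).2

theorem nil_of_mem_completeLie {f : Series K X} (hf : f ∈ completeLie d) : f [] = 0 := by
  have h : (freeLie d : Submodule K (Series K X))
      ≤ LinearMap.ker (⟨⟨fun f => f [], fun _ _ => rfl⟩, fun _ _ => rfl⟩ : Series K X →ₗ[K] K) := by
    refine freeLie_le d (fun x => ?_) (fun f hf g hg => ?_)
    · change (gen x : Series K X) [] = 0
      simp [gen]
    · have hf : f [] = 0 := hf
      have hg : g [] = 0 := hg
      change (bracket d f g) [] = 0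
      simp [bracket_apply, hf, hg, parity_apply]
  have := h (hf 0)
  change comp 0 f [] = 0 at this
  simpa [comp_apply] using this

theorem comp_deriv [Fintype X] (hL : ∀ x, c x ∈ completeLie d) (n : ℕ) (f : Series K X) :
    comp n (deriv d c f) = ∑ m ∈ range (n + 1), comp n (deriv d c (comp m f)) := by
  ext w
  simp only [sum_apply, comp_apply]
  split_ifs with h
  · simp only [deriv_apply]
    refine Eq.trans ?_ sum_comm
    refine sum_congr rfl fun i hi => Eq.trans ?_ sum_comm
    refine sum_congr rfl fun j hj => Eq.trans ?_ sum_comm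
    refine sum_congr rfl fun x _ => ?_
    simp only [comp_apply]
    rcases j with - | j
    · simp [nil_of_mem_completeLie d (hL x)]
    · rw [sum_eq_single (w.take i ++ x :: (w.drop i).drop (j + 1)).length]
      · simp
      · intro m _ hm
        rw [if_neg (Ne.symm hm), mul_zero]
      · intro hn
        exfalso
        apply hn
        have := mem_range.1 hi
        have := mem_range.1 hj
        simp
        omega
  · simp

theorem deriv_mem_completeLie [Fintype X] (hc : ∀ x, c x ∈ degPart d (d x - 1))
    (hL : ∀ x, c x ∈ completeLie d) {f : Series K X} (hf : f ∈ completeLie d) :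
    deriv d c f ∈ completeLie d := fun n => by
  rw [comp_deriv d hL]
  exact sum_mem fun m _ => deriv_mem_of_freeLie d hc hL (hf m) n

end derivLie

/-- The complete tensor algebra with its continuous derivation sending each generator `x`
to `c x`. -/
def preDGA [Fintype X] (c : X → Series K X) (hc : ∀ x, c x ∈ degPart d (d x - 1)) :
    PreDGA K (Series K X) where
  deg := degPart d
  parity := parity d
  diff := deriv d c
  one_mem := one_mem_degPart d
  mul_mem := mul_mem_degPart d
  parity_apply := parity_of_mem d
  parity_parity := parity_parity d
  diff_mem := deriv_mem_degPart d hc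
  parity_diff := parity_deriv d hc
  leibniz := deriv_mul d c

/-- The complete free Lie algebra with its continuous derivation sending each generator `x`
to `c x`. -/
def preDGL [CharZero K] [Fintype X] (c : X → Series K X) (hc : ∀ x, c x ∈ degPart d (d x - 1))
    (hL : ∀ x, c x ∈ completeLie d) : PreDGL K (completeLie d : Submodule K (Series K X)) where
  deg p := (degPart d p).comap (completeLie d).subtype
  parity := (parity d).toLinearMap.restrict fun _ hf => parity_mem_completeLie d hf
  bracket := LinearMap.mk₂ K
    (fun f g => ⟨bracket d f.1 g.1, bracket_mem_completeLie d f.2 g.2⟩)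
    (fun f f' g => by ext1; simp) (fun r f g => by ext1; simp)
    (fun f g g' => by ext1; simp) (fun r f g => by ext1; simp)
  diff := (deriv d c).restrict fun _ hf => deriv_mem_completeLie d hc hL hf
  parity_apply hx := Subtype.ext (parity_of_mem d hx)
  parity_parity x := Subtype.ext (parity_parity d x.1)
  parity_bracket x y := Subtype.ext (parity_bracket d x.1 y.1)
  bracket_mem hx hy := bracket_mem_degPart d hx hy
  antisymm hx hy :=
    Subtype.ext (bracket_antisymm d (congrArg Subtype.val hx) (congrArg Subtype.val hy))
  jacobi z hx hy :=
    Subtype.ext (bracket_jacobi d z.1 (congrArg Subtype.val hx) (congrArg Subtype.val hy))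
  diff_mem hx := deriv_mem_degPart d hc hx
  parity_diff x := Subtype.ext (parity_deriv d hc x.1)
  leibniz x y := Subtype.ext (deriv_bracket d hc x.1 y.1)

end graded

end Series

/-! ### The Lawrence–Sullivan construction -/

/-- The generators `a`, `b`, `z`. -/
inductive LSGen
  | a | b | z
  deriving DecidableEq

namespace LSGen

instance : Fintype LSGen := ⟨{a, b, z}, fun x => by cases x <;> simp⟩

/-- The degrees `-1`, `-1`, `0` of `a`, `b`, `z`. -/
def deg : LSGen → ℤ
  | a => -1
  | b => -1
  | z => 0

variable (K : Type*) [Field K]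

open Series

/-- `∂a = -½[a, a]`, `∂b = -½[b, b]` and `∂z = [z, b] + ∑ᵢ (Bᵢ / i!) ad_zⁱ(b - a)`, with the
Bernoulli numbers normalized by `B₁ = -½`. -/
def diff : LSGen → Series K LSGen
  | a => -(1 / 2 : K) • bracket deg (gen a) (gen a)
  | b => -(1 / 2 : K) • bracket deg (gen b) (gen b)
  | z => bracket deg (gen z) (gen b) + formalSum fun i =>
      (((bernoulli i : ℚ) : K) / (Nat.factorial i : K)) •
        (bracket deg (gen z))^[i] (gen b - gen a : Series K LSGen)

theorem diff_mem_degPart [CharZero K] (x : LSGen) : diff K x ∈ degPart deg (deg x - 1) := by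
  cases x with
  | a => exact Submodule.smul_mem _ _ (bracket_mem_degPart deg (gen_mem_degPart deg a)
      (gen_mem_degPart deg a))
  | b => exact Submodule.smul_mem _ _ (bracket_mem_degPart deg (gen_mem_degPart deg b)
      (gen_mem_degPart deg b))
  | z =>
    refine add_mem (bracket_mem_degPart deg (gen_mem_degPart deg z) (gen_mem_degPart deg b))
      (formalSum_mem_degPart deg fun i => Submodule.smul_mem _ _ ?_)
    induction i with
    | zero => exact sub_mem (gen_mem_degPart deg b) (gen_mem_degPart deg a)
    | succ i ih =>
      rw [Function.iterate_succ_apply']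
      exact bracket_mem_degPart deg (gen_mem_degPart deg z) ih

theorem diff_mem_completeLie (x : LSGen) : diff K x ∈ completeLie deg := by
  have hg := gen_mem_completeLie (K := K) deg
  cases x with
  | a => exact Submodule.smul_mem _ _ (bracket_mem_completeLie deg (hg a) (hg a))
  | b => exact Submodule.smul_mem _ _ (bracket_mem_completeLie deg (hg b) (hg b))
  | z =>
    refine add_mem (bracket_mem_completeLie deg (hg z) (hg b))
      (formalSum_mem_completeLie deg fun i => Submodule.smul_mem _ _ ?_)
    induction i with
    | zero => exact sub_mem (hg b) (hg a)
    | succ i ih =>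
      rw [Function.iterate_succ_apply']
      exact bracket_mem_completeLie deg (hg z) ih

end LSGen

/-- The Lawrence–Sullivan construction `𝔏`: the complete free Lie algebra on `a`, `b`, `z`
with the derivation `∂`. -/
def lawrenceSullivan (K : Type*) [Field K] [CharZero K] :
    PreDGL K (Series.completeLie LSGen.deg : Submodule K (Series K LSGen)) :=
  Series.preDGL LSGen.deg (LSGen.diff K) (LSGen.diff_mem_degPart K) (LSGen.diff_mem_completeLie K)

/-- The generators `a`, `b`, `z` as elements of `𝔏`. -/
def lsGen (K : Type*) [Field K] [CharZero K] (x : LSGen) :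
    (Series.completeLie LSGen.deg : Submodule K (Series K LSGen)) :=
  ⟨Series.gen x, Series.gen_mem_completeLie LSGen.deg x⟩

/-! ### The complete cylinder of `T(u)` -/

/-- The generators `u`, `u'`, `su`. -/
inductive CylGen
  | u | u' | su
  deriving DecidableEq

namespace CylGen

instance : Fintype CylGen := ⟨{u, u', su}, fun x => by cases x <;> simp⟩

/-- The degrees `-1`, `-1`, `0` of `u`, `u'`, `su`. -/
def deg : CylGen → ℤ
  | u => -1
  | u' => -1
  | su => 0

variable (K : Type*) [Field K]

open Series

/-- `Du = -u ⊗ u`, `Du' = -u' ⊗ u'` and `Dsu = su ⊗ u' - u' ⊗ su +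
∑ₙ ∑_{p+q=n} (-1)^q (Bₙ / (p! q!)) su^p ⊗ (u' - u) ⊗ su^q`. -/
def diff : CylGen → Series K CylGen
  | u => -(gen u * gen u)
  | u' => -(gen u' * gen u')
  | su => gen su * gen u' - gen u' * gen su + formalSum fun n =>
      ∑ pq ∈ antidiagonal n,
        ((-1 : K) ^ pq.2 * ((bernoulli n : ℚ) : K)
            / ((Nat.factorial pq.1 : K) * (Nat.factorial pq.2 : K))) •
          (gen su ^ pq.1 * (gen u' - gen u) * gen su ^ pq.2)

theorem diff_mem_degPart (x : CylGen) : diff K x ∈ degPart deg (deg x - 1) := by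
  have hg := gen_mem_degPart (K := K) deg
  cases x with
  | u => exact neg_mem (mul_mem_degPart deg (hg u) (hg u))
  | u' => exact neg_mem (mul_mem_degPart deg (hg u') (hg u'))
  | su =>
    have hpow : ∀ n : ℕ, (gen su : Series K CylGen) ^ n ∈ degPart deg 0 := by
      intro n
      induction n with
      | zero => rw [pow_zero]; exact one_mem_degPart deg
      | succ n ih => rw [pow_succ]; exact mul_mem_degPart deg ih (hg su)
    refine add_mem (sub_mem (mul_mem_degPart deg (hg su) (hg u'))
      (mul_mem_degPart deg (hg u') (hg su))) (formalSum_mem_degPart deg fun n =>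
        sum_mem fun pq _ => Submodule.smul_mem _ _ ?_)
    exact mul_mem_degPart (p := -1) (q := 0) deg
      (mul_mem_degPart (p := 0) (q := -1) deg (hpow _) (sub_mem (hg u') (hg u))) (hpow _)

end CylGen

/-- The complete cylinder of `T(u)`: the complete tensor algebra on `u`, `u'`, `su`
with the derivation `D`. -/
def completeCylinder (K : Type*) [Field K] : PreDGA K (Series K CylGen) :=
  Series.preDGA CylGen.deg (CylGen.diff K) (CylGen.diff_mem_degPart K)

end

/-! The complete enveloping algebra of a complete free Lie algebra is the complete tensor algebra on
the same generators, and its derivation is the one with the same values on generators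
(`envelopeEquiv`, `envelopeEquiv_isIso`). After renaming generators by `genEquiv`, two things
remain: the two differentials have matching values on generators, and the derivation squares to
zero.

Matching values: `a` is odd, so `[a, a] = 2a²`, and likewise for `b`. Since `z` is even, `ad_z` is
left minus right multiplication by `z`; these commute, so the binomial theorem turns `(Bₙ / n!)
ad_zⁿ` into the double sum defining `D su`. Both differentials are instances of `gaugeSeries`.

Square zero: let `x` and `y` denote left and right multiplication by `z`. For an ordinary derivation
`T` at `z`, one has `T (e^z) = E (T z)` with `E = (e^x - e^y) / (x - y)`. The Bernoulli series is
inverse to this up to an exponential, `E · (x - y) / (e^(x - y) - 1) = e^y`, so the formula for `∂z`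
is equivalent to `∂(e^z) = e^z b - a e^z`. Applying `∂` again, with `∂a = -a²` and `∂b = -b²`, gives
`∂²(e^z) = 0`. As `∂²` is itself a derivation, `E (∂²z) = 0`, and `E` is injective because it is the
identity plus terms raising the order.

The enveloping algebra: `U` is generated by infinite Lie series but completed along powers of its
augmentation ideal `I`, so one must know that `Iⁿ` consists exactly of the elements whose series has
order at least `n` (`mem_augIdeal_pow_iff`). This rests on `exists_eq_sum_bracket_gen`: as there are
finitely many generators, a Lie series of order at least `n + 1`, with `n ≥ 1`, is a finite sum of
brackets of generators with Lie series of order at least `n`. By induction such series lie in the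
powers of `I`, so modulo `Iⁿ` everything is a combination of words, and words are linearly
independent in the tensor algebra. -/

namespace Series

noncomputable section

variable {K X Y : Type*} [Field K]

/-! ### The filtration by order, and formal sums. -/

/-- The series which only involve words of length at least `n`. -/
def ordGE (n : ℕ) : Submodule K (Series K X) where
  carrier := {f | ∀ w, w.length < n → f w = 0}
  add_mem' hf hg w hw := by simp [hf w hw, hg w hw]
  zero_mem' _ _ := rfl
  smul_mem' r f hf w hw := by simp [hf w hw]

theorem ordGE_anti {m n : ℕ} (h : m ≤ n) : (ordGE n : Submodule K (Series K X)) ≤ ordGE m :=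
  fun _ hf w hw => hf w (hw.trans_le h)

theorem mem_ordGE_zero (f : Series K X) : f ∈ (ordGE 0 : Submodule K (Series K X)) :=
  fun _ hw => absurd hw (Nat.not_lt_zero _)

theorem mul_mem_ordGE {m n : ℕ} {f g : Series K X} (hf : f ∈ ordGE m) (hg : g ∈ ordGE n) :
    f * g ∈ ordGE (m + n) := by
  intro w hw
  rw [mul_apply]
  refine sum_eq_zero fun i hi => ?_
  by_cases h : (w.take i).length < m
  · rw [hf _ h, zero_mul]
  · rw [hg (w.drop i), mul_zero]
    rw [List.length_take] at h
    rw [List.length_drop]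
    omega

theorem gen_mem_ordGE (x : X) : (gen x : Series K X) ∈ ordGE 1 := by
  intro w hw
  refine if_neg ?_
  rintro rfl
  simp at hw

theorem parity_mem_ordGE (d : X → ℤ) {n : ℕ} {f : Series K X} (hf : f ∈ ordGE n) :
    parity d f ∈ ordGE n := fun w hw => by rw [parity_apply, hf w hw, mul_zero]

/-- The derivation replaces one letter by the words of some `c x`; as `c x` has no constant term, no
word gets shorter. This is the continuity of the derivation. -/
theorem deriv_mem_ordGE [Fintype X] (d : X → ℤ) {c : X → Series K X} (hc : ∀ x, c x [] = 0)
    {n : ℕ} {f : Series K X} (hf : f ∈ ordGE n) : deriv d c f ∈ ordGE n := by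
  intro w hw
  rw [deriv_apply]
  refine sum_eq_zero fun i hi => sum_eq_zero fun j hj => sum_eq_zero fun x _ => ?_
  rcases j with - | j
  · simp [hc]
  · rw [hf, mul_zero]
    have := mem_range.1 hi
    have := mem_range.1 hj
    simp
    omega

theorem eq_zero_of_forall_mem_ordGE {f : Series K X} (h : ∀ n, f ∈ ordGE n) : f = 0 := by
  ext w
  exact h (w.length + 1) w (Nat.lt_succ_self _)

theorem eq_of_forall_sub_mem_ordGE {f g : Series K X} (h : ∀ n, f - g ∈ ordGE n) : f = g :=
  sub_eq_zero.1 (eq_zero_of_forall_mem_ordGE h)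

/-- Terms of index greater than the length of a word vanish on it, so the truncation built into
`formalSum` loses nothing and the sum is the limit of its partial sums. -/
theorem formalSum_sub_mem_ordGE {t : ℕ → Series K X} (ht : ∀ n, t n ∈ ordGE n) (N : ℕ) :
    formalSum t - ∑ n ∈ range N, t n ∈ ordGE N := by
  intro w hw
  rw [sub_apply, sum_apply, sub_eq_zero]
  refine sum_subset (range_mono hw) fun n _ hn => ht n w ?_
  simpa using hn

theorem formalSum_mem_ordGE {t : ℕ → Series K X} {N : ℕ} (ht : ∀ n, t n ∈ ordGE N) :
    formalSum t ∈ ordGE N := fun w hw =>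
  Finset.sum_eq_zero (s := range (w.length + 1)) fun n _ => ht n w hw

/-- A linear map which does not lower the order is continuous. -/
theorem map_formalSum (T : Series K X →ₗ[K] Series K Y)
    (hT : ∀ n, ∀ f ∈ ordGE n, T f ∈ ordGE n) {t : ℕ → Series K X} (ht : ∀ n, t n ∈ ordGE n) :
    T (formalSum t) = formalSum fun n => T (t n) := by
  refine eq_of_forall_sub_mem_ordGE fun N => ?_
  have h1 := hT N _ (formalSum_sub_mem_ordGE ht N)
  have h2 := formalSum_sub_mem_ordGE (fun n => hT n _ (ht n)) N
  rw [map_sub, map_sum] at h1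
  simpa using sub_mem h1 h2

theorem formalSum_eq_single {t : ℕ → Series K X} (k : ℕ) (hk : t k ∈ ordGE k)
    (ht : ∀ n, n ≠ k → t n = 0) : formalSum t = t k := by
  ext w
  change ∑ n ∈ range (w.length + 1), t n w = t k w
  by_cases h : k ∈ range (w.length + 1)
  · rw [sum_eq_single k (fun n _ hn => by rw [ht n hn]; rfl) fun hn => absurd h hn]
  · rw [hk w (by simpa using h)]
    refine sum_eq_zero fun n hn => ?_
    rw [ht n (by rintro rfl; exact h hn)]
    rfl

theorem formalSum_succ {t : ℕ → Series K X} (h0 : t 0 = 0) (ht : ∀ n, t n ∈ ordGE n) :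
    formalSum t = formalSum fun n => t (n + 1) := by
  ext w
  change ∑ n ∈ range (w.length + 1), t n w = ∑ n ∈ range (w.length + 1), t (n + 1) w
  -- On a word `w` the shifted sum has the extra term of index `w.length + 1`, which vanishes
  -- because of its order.
  rw [sum_range_succ', sum_range_succ, h0, ht (w.length + 1) w (Nat.lt_succ_self _)]
  rfl

theorem formalSum_formalSum {s : ℕ → ℕ → Series K X} (hs : ∀ m n, s m n ∈ ordGE (m + n)) :
    (formalSum fun m => formalSum fun n => s m n)
      = formalSum fun k => ∑ p ∈ antidiagonal k, s p.1 p.2 := by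
  ext w
  change ∑ m ∈ range (w.length + 1), ∑ n ∈ range (w.length + 1), s m n w
    = ∑ k ∈ range (w.length + 1), (∑ p ∈ antidiagonal k, s p.1 p.2) w
  simp only [sum_apply]
  rw [← sum_product', sum_sigma']
  symm
  -- On a fixed word the left side is a sum over a square of indices and the right side over the
  -- triangle `m + n ≤ w.length` inside it. Outside the triangle the order of `s m n` exceeds the
  -- length of the word.
  refine sum_of_injOn (fun p => p.2) ?_ ?_ ?_ ?_
  · rintro ⟨k, p⟩ hp ⟨k', p'⟩ hp' h
    simp only [coe_sigma, Set.mem_sigma_iff, mem_coe,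
      HasAntidiagonal.mem_antidiagonal] at hp hp' h
    subst h
    obtain rfl : k = k' := hp.2.symm.trans hp'.2
    rfl
  · rintro ⟨k, p⟩ hp
    simp only [coe_sigma, Set.mem_sigma_iff, mem_coe, HasAntidiagonal.mem_antidiagonal, mem_range, coe_product,
      Set.mem_prod] at hp ⊢
    omega
  · rintro ⟨m, n⟩ _ hmn
    refine hs m n w ?_
    by_contra h
    refine hmn ⟨⟨m + n, (m, n)⟩, ?_, rfl⟩
    simp
    omega
  · intros; rfl

theorem formalSum_add (s t : ℕ → Series K X) :
    (formalSum fun n => s n + t n) = formalSum s + formalSum t := by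
  ext w
  simp [formalSum, sum_add_distrib]

theorem formalSum_smul (r : K) (t : ℕ → Series K X) :
    (formalSum fun n => r • t n) = r • formalSum t := by
  ext w
  simp [formalSum, mul_sum]

/-! ### Monomials -/

open Classical in
theorem prod_map_gen_apply (w v : List X) :
    ((w.map gen).prod : Series K X) v = if v = w then 1 else 0 := by
  induction w generalizing v with
  | nil => simp [one_apply]
  | cons x w ih =>
    rw [List.map_cons, List.prod_cons]
    cases v with
    | nil => simp [gen]
    | cons y v =>
      have h : shift y (gen x : Series K X) = if y = x then 1 else 0 := by
        ext w
        by_cases hy : y = x <;> cases w <;> simp [gen, hy, one_apply]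
      rw [mul_cons, h]
      by_cases hy : y = x <;> simp [gen, hy, ih]

/-- The words of length less than `n`. -/
def wordsLT (X : Type*) [Finite X] (n : ℕ) : Finset (List X) := (List.finite_length_lt X n).toFinset

@[simp] theorem mem_wordsLT [Finite X] {n : ℕ} {w : List X} : w ∈ wordsLT X n ↔ w.length < n := by
  simp [wordsLT]

/-- Polynomials in the generators are dense; finiteness of the set of generators makes each
truncation a finite sum. -/
theorem sum_wordsLT_sub_mem_ordGE [Finite X] (n : ℕ) (f : Series K X) :
    (∑ w ∈ wordsLT X n, f w • (w.map gen).prod) - f ∈ ordGE n := by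
  classical
  intro v hv
  rw [sub_apply, sum_apply, sum_eq_single v]
  · simp [prod_map_gen_apply]
  · intro w _ hw
    simp [prod_map_gen_apply, Ne.symm hw]
  · intro h
    exact absurd (mem_wordsLT.2 hv) h

/-! ### Power series in the left and right multiplications by an element -/

/-- The action of polynomials in two variables on series, through left and right
multiplication by `z`. -/
def biaction (z : Series K X) : Polynomial (Polynomial K) →+* Module.End K (Series K X) :=
  Polynomial.eval₂RingHom' (Polynomial.aeval (LinearMap.mulLeft K z)).toRingHom
    (LinearMap.mulRight K z) fun p => by
      induction p using Polynomial.induction_on' with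
      | add p q hp hq => rw [map_add]; exact hp.add_left hq
      | monomial n r =>
        change Commute (Polynomial.aeval _ (Polynomial.monomial n r)) _
        rw [Polynomial.aeval_monomial]
        exact Commute.mul_left (Algebra.commutes r _)
          ((LinearMap.commute_mulLeft_right (R := K) z z).pow_left n)

/-- The variable acting by left multiplication. -/
abbrev leftVar (K : Type*) [Field K] : Polynomial (Polynomial K) := Polynomial.C Polynomial.X

/-- The variable acting by right multiplication. -/
abbrev rightVar (K : Type*) [Field K] : Polynomial (Polynomial K) := Polynomial.X

@[simp] theorem biaction_leftVar (z : Series K X) :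
    biaction z (leftVar K) = LinearMap.mulLeft K z := by
  simp [biaction]

@[simp] theorem biaction_rightVar (z : Series K X) :
    biaction z (rightVar K) = LinearMap.mulRight K z := by
  simp [biaction]

theorem biaction_algebraMap (z : Series K X) (r : K) (g : Series K X) :
    biaction z (algebraMap K _ r) g = r • g := by
  rw [Polynomial.algebraMap_apply, Polynomial.algebraMap_apply]
  simp [biaction]

theorem biaction_algebraMap_rat [CharZero K] (z : Series K X) (r : ℚ) (g : Series K X) :
    biaction z (algebraMap ℚ _ r) g = (r : K) • g := by
  rw [IsScalarTower.algebraMap_apply ℚ K, biaction_algebraMap, eq_ratCast]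

/-- The polynomial `p` acts by raising the order by `n`. -/
def Raises (z : Series K X) (n : ℕ) (p : Polynomial (Polynomial K)) : Prop :=
  ∀ m, ∀ g ∈ (ordGE m : Submodule K (Series K X)), biaction z p g ∈ ordGE (n + m)

theorem Raises.mul {z : Series K X} {m n : ℕ} {p q : Polynomial (Polynomial K)}
    (hp : Raises z m p) (hq : Raises z n q) : Raises z (m + n) (p * q) := fun k g hg => by
  rw [map_mul, add_assoc]
  exact hp _ _ (hq _ _ hg)

theorem Raises.add {z : Series K X} {n : ℕ} {p q : Polynomial (Polynomial K)}
    (hp : Raises z n p) (hq : Raises z n q) : Raises z n (p + q) := fun k g hg => by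
  rw [map_add]
  exact add_mem (hp _ _ hg) (hq _ _ hg)

theorem Raises.sub {z : Series K X} {n : ℕ} {p q : Polynomial (Polynomial K)}
    (hp : Raises z n p) (hq : Raises z n q) : Raises z n (p - q) := fun k g hg => by
  rw [map_sub]
  exact sub_mem (hp _ _ hg) (hq _ _ hg)

theorem Raises.sum {ι : Type*} {z : Series K X} {n : ℕ} {s : Finset ι}
    {p : ι → Polynomial (Polynomial K)} (hp : ∀ i ∈ s, Raises z n (p i)) :
    Raises z n (∑ i ∈ s, p i) := fun k g hg => by
  rw [map_sum, LinearMap.sum_apply]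
  exact sum_mem fun i hi => hp i hi _ _ hg

theorem raises_algebraMap_rat [CharZero K] (z : Series K X) (r : ℚ) :
    Raises z 0 (algebraMap ℚ _ r) := fun k g hg => by
  rw [biaction_algebraMap_rat, zero_add]
  exact Submodule.smul_mem _ _ hg

theorem Raises.pow {z : Series K X} {p : Polynomial (Polynomial K)} (hp : Raises z 1 p) (n : ℕ) :
    Raises z n (p ^ n) := by
  induction n with
  | zero => intro k g hg; simpa using hg
  | succ n ih => rw [pow_succ]; exact ih.mul hp

theorem raises_leftVar {z : Series K X} (hz : z ∈ ordGE 1) : Raises z 1 (leftVar K) :=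
  fun _ _ hg => by rw [biaction_leftVar]; exact mul_mem_ordGE hz hg

theorem raises_rightVar {z : Series K X} (hz : z ∈ ordGE 1) : Raises z 1 (rightVar K) :=
  fun _ _ hg => by rw [biaction_rightVar, add_comm]; exact mul_mem_ordGE hg hz

/-- The action of a power series whose `n`-th coefficient raises the order by `n`. -/
def seriesAction (z : Series K X) (F : PowerSeries (Polynomial (Polynomial K))) :
    Series K X →ₗ[K] Series K X where
  toFun g := formalSum fun n => biaction z (PowerSeries.coeff n F) g
  map_add' f g := by simp only [map_add]; exact formalSum_add _ _
  map_smul' r g := by simp only [map_smul]; exact formalSum_smul _ _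

theorem seriesAction_apply (z : Series K X) (F : PowerSeries (Polynomial (Polynomial K)))
    (g : Series K X) :
    seriesAction z F g = formalSum fun n => biaction z (PowerSeries.coeff n F) g := rfl

theorem seriesAction_mem_ordGE {z : Series K X} {F : PowerSeries (Polynomial (Polynomial K))}
    (hF : ∀ n, Raises z n (PowerSeries.coeff n F)) {n : ℕ} {g : Series K X} (hg : g ∈ ordGE n) :
    seriesAction z F g ∈ ordGE n :=
  formalSum_mem_ordGE fun k => ordGE_anti (Nat.le_add_left n k) (hF k n g hg)

/-- This transfers identities between commutative power series to the noncommutative algebra: a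
product of series acts as a composite of operators. It holds because the operators are continuous
for the order filtration and the double sum can be regrouped by total degree. -/
theorem seriesAction_mul {z : Series K X} {F G : PowerSeries (Polynomial (Polynomial K))}
    (hF : ∀ n, Raises z n (PowerSeries.coeff n F)) (hG : ∀ n, Raises z n (PowerSeries.coeff n G))
    (g : Series K X) : seriesAction z (F * G) g = seriesAction z F (seriesAction z G g) := by
  have hg : ∀ n, biaction z (PowerSeries.coeff n G) g ∈ ordGE n := fun n =>
    hG n 0 g (mem_ordGE_zero g)
  rw [seriesAction_apply z G, map_formalSum _ (fun n f => seriesAction_mem_ordGE hF) hg]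
  simp only [seriesAction_apply]
  rw [formalSum_formalSum fun m n => by rw [add_comm]; exact hF n m _ (hg m)]
  congr 1
  funext k
  rw [PowerSeries.coeff_mul, ← Nat.sum_antidiagonal_swap, map_sum, LinearMap.sum_apply]
  simp

theorem seriesAction_C_mul_X {z : Series K X} {p : Polynomial (Polynomial K)} (hp : Raises z 1 p)
    (g : Series K X) : seriesAction z (PowerSeries.C p * PowerSeries.X) g = biaction z p g := by
  rw [seriesAction_apply, formalSum_eq_single 1]
  · simp
  · simpa using hp 0 g (mem_ordGE_zero g)
  · intro n hn
    simp [PowerSeries.coeff_X, hn]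

theorem raises_C_mul_X {z : Series K X} {p : Polynomial (Polynomial K)} (hp : Raises z 1 p)
    (n : ℕ) : Raises z n (PowerSeries.coeff n (PowerSeries.C p * PowerSeries.X)) := by
  by_cases hn : n = 1
  · subst hn; simpa using hp
  · intro k g _
    simp [PowerSeries.coeff_X, hn, zero_mem]

theorem pow_mem_ordGE {z : Series K X} (hz : z ∈ ordGE 1) (n : ℕ) : z ^ n ∈ ordGE n := by
  induction n with
  | zero => exact mem_ordGE_zero _
  | succ n ih => rw [pow_succ]; exact mul_mem_ordGE ih hz

/-- The Leibniz rule gives the sum of all `zⁱ (T z) zʲ` with `i + j = n - 1`. The hypothesis is the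
rule without signs on powers of `z` only, so that it covers both an odd derivation at an even `z`
and the square of an odd derivation. -/
theorem map_pow_of_leibniz {z : Series K X} (T : Series K X →ₗ[K] Series K X) (h1 : T 1 = 0)
    (hT : ∀ n, T (z ^ n * z) = T (z ^ n) * z + z ^ n * T z) (n : ℕ) :
    T (z ^ n) = biaction z
      (∑ i ∈ range n, leftVar K ^ i * rightVar K ^ (n - 1 - i)) (T z) := by
  induction n with
  | zero => simp [h1]
  | succ n ih =>
    rw [pow_succ, hT, ih, Nat.add_sub_cancel, geom_sum₂_succ_eq, map_add, map_mul, map_pow,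
      biaction_leftVar, biaction_rightVar, LinearMap.pow_mulLeft, LinearMap.add_apply,
      Module.End.mul_apply, LinearMap.mulLeft_apply, LinearMap.mulRight_apply, add_comm]

/-! ### Exponentials, the Bernoulli series and the equation for `∂z`. -/

section exponential

variable [CharZero K]

theorem raises_rescale_bernoulli {z : Series K X} {p : Polynomial (Polynomial K)}
    (hp : Raises z 1 p) (n : ℕ) :
    Raises z n (PowerSeries.coeff n (PowerSeries.rescale p (bernoulliPowerSeries _))) := by
  rw [PowerSeries.coeff_rescale, bernoulliPowerSeries, PowerSeries.coeff_mk]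
  exact (hp.pow n).mul (raises_algebraMap_rat z _)

/-- The power series `(exp (x t) - exp (y t)) / ((x - y) t)`. -/
def expQuotient (K : Type*) [Field K] [CharZero K] : PowerSeries (Polynomial (Polynomial K)) :=
  PowerSeries.mk fun n => (∑ i ∈ range (n + 1), leftVar K ^ i * rightVar K ^ (n + 1 - 1 - i)) *
    algebraMap ℚ _ (1 / (n + 1).factorial)

theorem raises_expQuotient {z : Series K X} (hz : z ∈ ordGE 1) (n : ℕ) :
    Raises z n (PowerSeries.coeff n (expQuotient K)) := by
  rw [expQuotient, PowerSeries.coeff_mk]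
  refine (Raises.sum fun i hi => ?_).mul (raises_algebraMap_rat z _)
  have h := ((raises_leftVar hz).pow i).mul ((raises_rightVar hz).pow (n + 1 - 1 - i))
  rwa [Nat.add_sub_cancel, Nat.add_sub_cancel' (Nat.lt_succ_iff.1 (mem_range.1 hi))] at h

/-- In each degree this is the factorization of `xⁿ - yⁿ` by `x - y`. -/
theorem expQuotient_mul :
    expQuotient K * (PowerSeries.C (leftVar K - rightVar K) * PowerSeries.X)
      = PowerSeries.rescale (leftVar K) (PowerSeries.exp _)
        - PowerSeries.rescale (rightVar K) (PowerSeries.exp _) := by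
  ext1 n
  rw [← mul_assoc]
  rcases n with - | n
  · rw [map_sub (PowerSeries.coeff 0), PowerSeries.coeff_rescale, PowerSeries.coeff_rescale]
    simp
  · rw [PowerSeries.coeff_succ_mul_X, PowerSeries.coeff_mul_C, expQuotient, PowerSeries.coeff_mk,
      map_sub, PowerSeries.coeff_rescale, PowerSeries.coeff_rescale, PowerSeries.coeff_exp,
      ← sub_mul, ← geom_sum₂_mul]
    ring

/-- Formally `(e^x - e^y) / (x - y) · (x - y) / (e^(x - y) - 1) = e^y`, because `e^x - e^y = e^y
(e^(x - y) - 1)`. This is where the Bernoulli numbers enter. -/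
theorem expQuotient_mul_bernoulli :
    expQuotient K * PowerSeries.rescale (leftVar K - rightVar K) (bernoulliPowerSeries _)
      = PowerSeries.rescale (rightVar K) (PowerSeries.exp _) := by
  have h1 := congrArg (PowerSeries.rescale (leftVar K - rightVar K))
    (bernoulliPowerSeries_mul_exp_sub_one (Polynomial (Polynomial K)))
  rw [map_mul, map_sub, map_one, PowerSeries.rescale_X] at h1
  have h2 := PowerSeries.exp_mul_exp_eq_exp_add (rightVar K) (leftVar K - rightVar K)
  rw [add_sub_cancel] at h2
  -- The series ring is a domain, so the factor `e^(x - y) - 1` may be cancelled once it is nonzero: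
  -- its linear coefficient `x - y` has coefficient `-1` at `y`.
  have h3 : PowerSeries.rescale (leftVar K - rightVar K)
      (PowerSeries.exp (Polynomial (Polynomial K))) - 1 ≠ 0 := by
    intro h
    have h := congrArg (PowerSeries.coeff 1) h
    rw [map_sub, PowerSeries.coeff_rescale, PowerSeries.coeff_exp] at h
    have h := congrArg (Polynomial.coeff · 1) h
    simp [PowerSeries.coeff_one] at h
  refine mul_right_cancel₀ h3 ?_
  rw [mul_assoc, h1, expQuotient_mul, ← h2]
  ring

/-- The exponential of a series without constant term. -/
def expSeries (z : Series K X) : Series K X :=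
  formalSum fun n => ((1 / n.factorial : ℚ) : K) • z ^ n

theorem seriesAction_rescale_left_exp {z : Series K X} (hz : z ∈ ordGE 1) (g : Series K X) :
    seriesAction z (PowerSeries.rescale (leftVar K) (PowerSeries.exp _)) g
      = expSeries z * g := by
  have h := map_formalSum (LinearMap.mulRight K g) (fun n f hf => mul_mem_ordGE hf
    (mem_ordGE_zero g)) fun n => Submodule.smul_mem _ ((1 / n.factorial : ℚ) : K)
      (pow_mem_ordGE hz n)
  rw [LinearMap.mulRight_apply] at h
  rw [expSeries, h, seriesAction_apply]
  congr 1
  funext n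
  rw [PowerSeries.coeff_rescale, PowerSeries.coeff_exp, map_mul, Module.End.mul_apply,
    biaction_algebraMap_rat, map_pow, biaction_leftVar, LinearMap.pow_mulLeft]
  simp

theorem seriesAction_rescale_right_exp {z : Series K X} (hz : z ∈ ordGE 1) (g : Series K X) :
    seriesAction z (PowerSeries.rescale (rightVar K) (PowerSeries.exp _)) g
      = g * expSeries z := by
  have h := map_formalSum (LinearMap.mulLeft K g) (fun n f hf => by
    simpa using mul_mem_ordGE (mem_ordGE_zero g) hf) fun n =>
      Submodule.smul_mem _ ((1 / n.factorial : ℚ) : K) (pow_mem_ordGE hz n)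
  rw [LinearMap.mulLeft_apply] at h
  rw [expSeries, h, seriesAction_apply]
  congr 1
  funext n
  rw [PowerSeries.coeff_rescale, PowerSeries.coeff_exp, map_mul, Module.End.mul_apply,
    biaction_algebraMap_rat, map_pow, biaction_rightVar, LinearMap.pow_mulRight]
  simp

/-- The derivative of an exponential. -/
theorem map_expSeries_of_leibniz {z : Series K X} (hz : z ∈ ordGE 1)
    (T : Series K X →ₗ[K] Series K X) (hord : ∀ n, ∀ f ∈ ordGE n, T f ∈ ordGE n) (h1 : T 1 = 0)
    (hT : ∀ n, T (z ^ n * z) = T (z ^ n) * z + z ^ n * T z) :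
    T (expSeries z) = seriesAction z (expQuotient K) (T z) := by
  have hpow : ∀ n, ((1 / n.factorial : ℚ) : K) • z ^ n ∈ ordGE n := fun n =>
    Submodule.smul_mem _ _ (pow_mem_ordGE hz n)
  rw [expSeries, map_formalSum T hord hpow, formalSum_succ (by simp [h1])
    fun n => hord n _ (hpow n), seriesAction_apply]
  congr 1
  funext n
  rw [map_smul, map_pow_of_leibniz T h1 hT, expQuotient, PowerSeries.coeff_mk, map_mul,
    Module.End.mul_apply, biaction_algebraMap_rat, map_smul]

/-- An element on which the differential of the exponential vanishes is zero. -/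
theorem eq_zero_of_seriesAction_expQuotient {z g : Series K X} (hz : z ∈ ordGE 1)
    (h : seriesAction z (expQuotient K) g = 0) : g = 0 := by
  refine eq_zero_of_forall_mem_ordGE fun n => ?_
  induction n with
  | zero => exact mem_ordGE_zero g
  | succ n ih =>
    have hmem : ∀ k, biaction z (PowerSeries.coeff k (expQuotient K)) g ∈ ordGE k := fun k =>
      raises_expQuotient hz k 0 g (mem_ordGE_zero g)
    intro w hw
    have hw0 := congrArg (fun f : Series K X => f w) h
    change ∑ k ∈ range (w.length + 1), biaction z (PowerSeries.coeff k (expQuotient K)) g w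
      = 0 at hw0
    -- If `g` has order at least `n`, every coefficient of positive index sends it to order at least
    -- `n + 1`; on words of length at most `n` only the constant coefficient acts, and it is `1`.
    rw [sum_range_succ', sum_eq_zero fun k _ => raises_expQuotient hz (k + 1) n g ih w (by omega),
      zero_add] at hw0
    have h0 : PowerSeries.coeff 0 (expQuotient K) = 1 := by simp [expQuotient]
    rwa [h0, map_one] at hw0

/-- The right hand side of the Lawrence–Sullivan equation for `∂z`, for an even element `z`. -/
def gaugeSeries (a b z : Series K X) : Series K X :=
  z * b - b * z + seriesAction z
    (PowerSeries.rescale (leftVar K - rightVar K) (bernoulliPowerSeries _)) (b - a)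

/-- The commutator `(x - y) b` becomes `(e^x - e^y) b = e^z b - b e^z`, and the Bernoulli part
becomes `e^y (b - a) = (b - a) e^z`; the two terms `b e^z` cancel. The complicated equation for `∂z`
thus says that `∂(e^z) = e^z b - a e^z`. -/
theorem seriesAction_expQuotient_gaugeSeries {z : Series K X} (hz : z ∈ ordGE 1)
    (a b : Series K X) :
    seriesAction z (expQuotient K) (gaugeSeries a b z) = expSeries z * b - a * expSeries z := by
  have hl : Raises z 1 (leftVar K - rightVar K) := (raises_leftVar hz).sub (raises_rightVar hz)
  have h : z * b - b * z = seriesAction z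
      (PowerSeries.C (leftVar K - rightVar K) * PowerSeries.X) b := by
    rw [seriesAction_C_mul_X hl, map_sub, biaction_leftVar, biaction_rightVar]
    rfl
  have hsub : ∀ F G : PowerSeries (Polynomial (Polynomial K)), ∀ g,
      seriesAction z (F - G) g = seriesAction z F g - seriesAction z G g := fun F G g => by
    rw [eq_sub_iff_add_eq, seriesAction_apply, seriesAction_apply, ← formalSum_add,
      seriesAction_apply]
    simp
  rw [gaugeSeries, h, map_add, ← seriesAction_mul (raises_expQuotient hz) (raises_C_mul_X hl),
    ← seriesAction_mul (raises_expQuotient hz) (raises_rescale_bernoulli hl), expQuotient_mul,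
    expQuotient_mul_bernoulli, hsub, seriesAction_rescale_left_exp hz,
    seriesAction_rescale_right_exp hz, seriesAction_rescale_right_exp hz]
  noncomm_ring

end exponential

/-! ### Squares of derivations -/

section square

variable [Fintype X] (d : X → ℤ) {c : X → Series K X}

theorem deriv_one (c : X → Series K X) : deriv d c 1 = 0 := by
  have h := deriv_mul d c 1 1
  rw [mul_one, map_one (parity d), one_mul, mul_one] at h
  exact left_eq_add.1 h

/-- The cross terms cancel because the odd derivation anticommutes with the parity operator: the
square is a derivation without signs. -/
theorem deriv_deriv_mul (hc : ∀ x, c x ∈ degPart d (d x - 1)) (f g : Series K X) :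
    deriv d c (deriv d c (f * g)) = deriv d c (deriv d c f) * g + f * deriv d c (deriv d c g) := by
  rw [deriv_mul, map_add, deriv_mul, deriv_mul, parity_deriv d hc, parity_parity, neg_mul]
  abel

/-- The square of an odd derivation vanishes when it vanishes on the generators. -/
theorem deriv_deriv_eq_zero (hc : ∀ x, c x ∈ degPart d (d x - 1)) (h0 : ∀ x, c x [] = 0)
    (hsq : ∀ x, deriv d c (c x) = 0) (f : Series K X) : deriv d c (deriv d c f) = 0 := by
  have hw : ∀ w : List X, deriv d c (deriv d c (w.map gen).prod) = 0 := fun w => by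
    induction w with
    | nil => simp [deriv_one]
    | cons x w ih =>
      rw [List.map_cons, List.prod_cons, deriv_deriv_mul d hc, ih, deriv_gen, hsq]
      simp
  -- The square vanishes on words, hence on truncations, and it does not lower the order of the
  -- remainder.
  refine eq_zero_of_forall_mem_ordGE fun n => ?_
  have h := deriv_mem_ordGE d h0 (deriv_mem_ordGE d h0 (sum_wordsLT_sub_mem_ordGE n f))
  rw [map_sub, map_sub, map_sum, map_sum, sum_eq_zero fun w _ => by
    rw [map_smul, map_smul, hw, smul_zero], zero_sub] at h
  exact neg_mem_iff.1 h

/-- The derivation of the Lawrence–Sullivan construction squares to zero on `z`. -/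
theorem deriv_gaugeSeries_eq_zero [CharZero K] (hc : ∀ x, c x ∈ degPart d (d x - 1))
    (h0 : ∀ x, c x [] = 0) {a b z : X} (ha : d a = -1) (hz : d z = 0)
    (hca : c a = -(gen a * gen a)) (hcb : c b = -(gen b * gen b))
    (hcz : c z = gaugeSeries (gen a) (gen b) (gen z)) : deriv d c (c z) = 0 := by
  have hz1 : (gen z : Series K X) ∈ ordGE 1 := gen_mem_ordGE z
  have hpz : parity d (gen z : Series K X) = gen z := by rw [parity_gen, hz]; simp
  have hpow : ∀ n, parity d (gen z ^ n : Series K X) = gen z ^ n := fun n => by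
    rw [map_pow, hpz]
  have hpa : parity d (gen a : Series K X) = -gen a := by rw [parity_gen, ha]; simp
  have hpe : parity d (expSeries (gen z : Series K X)) = expSeries (gen z) := by
    have h := map_formalSum (parity d).toLinearMap (fun n f hf => parity_mem_ordGE d hf)
      fun n => Submodule.smul_mem _ ((1 / n.factorial : ℚ) : K) (pow_mem_ordGE hz1 n)
    rw [AlgHom.toLinearMap_apply] at h
    rw [expSeries, h]
    simp [hpz]
  have hord : ∀ n, ∀ f ∈ (ordGE n : Submodule K (Series K X)), deriv d c f ∈ ordGE n :=
    fun n f hf => deriv_mem_ordGE d h0 hf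
  -- Powers of `z` are even, so the graded Leibniz rule has no sign on them.
  have h1 := map_expSeries_of_leibniz hz1 (deriv d c) hord (deriv_one d c) fun n => by
    rw [deriv_mul, hpow]
  rw [deriv_gen, hcz, seriesAction_expQuotient_gaugeSeries hz1] at h1
  -- The same chain rule is applied to `∂²`. What remains of `∂(e^z b - a e^z)` cancels by `∂a =
  -- -a²` and `∂b = -b²`.
  have h2 := map_expSeries_of_leibniz hz1 (deriv d c ∘ₗ deriv d c)
    (fun n f hf => hord n _ (hord n f hf)) (by simp [deriv_one]) fun n => deriv_deriv_mul d hc _ _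
  rw [LinearMap.comp_apply, LinearMap.comp_apply, deriv_gen, h1, map_sub, deriv_mul, deriv_mul,
    h1, hpe, hpa, deriv_gen, deriv_gen, hca, hcb] at h2
  refine eq_zero_of_seriesAction_expQuotient hz1 (h2.symm.trans ?_)
  noncomm_ring

end square

/-! ### Brackets with generators -/

section brackets

variable (d : X → ℤ)

/-- The graded laws are available only for even and odd elements. The last clause keeps both parts
inside any subspace that contains `f` and its parity image, which is how inductions over brackets
reduce to the homogeneous case. -/
theorem exists_even_add_odd [CharZero K] (f : Series K X) : ∃ f₀ f₁ : Series K X, f = f₀ + f₁ ∧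
    parity d f₀ = (-1 : K) ^ (0 : ℤ) • f₀ ∧ parity d f₁ = (-1 : K) ^ (1 : ℤ) • f₁ ∧
    ∀ S : Submodule K (Series K X), f ∈ S → parity d f ∈ S → f₀ ∈ S ∧ f₁ ∈ S := by
  refine ⟨(2 : K)⁻¹ • (f + parity d f), (2 : K)⁻¹ • (f - parity d f), ?_, ?_, ?_, fun S h h' =>
    ⟨S.smul_mem _ (add_mem h h'), S.smul_mem _ (sub_mem h h')⟩⟩
  · rw [← smul_add, add_add_sub_cancel, ← two_smul K f, smul_smul, inv_mul_cancel₀ two_ne_zero,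
      one_smul]
  · rw [map_smul, map_add, parity_parity, zpow_zero, one_smul, add_comm]
  · rw [map_smul, map_sub, parity_parity, zpow_one, neg_one_smul, ← smul_neg, neg_sub]

theorem comp_gen (n : ℕ) (x : X) : comp n (gen x : Series K X) = if n = 1 then gen x else 0 := by
  ext w
  rw [comp_apply]
  by_cases hw : w = [x]
  · subst hw
    by_cases h : n = 1 <;> simp [h, Ne.symm]
  · split_ifs <;> simp [gen, hw]

theorem comp_succ_bracket_gen (n : ℕ) (x : X) (f : Series K X) :
    comp (n + 1) (bracket d (gen x) f) = bracket d (gen x) (comp n f) := by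
  rw [comp_bracket, sum_eq_single (1, n)]
  · simp [comp_gen]
  · rintro ⟨i, j⟩ hij hne
    rw [comp_gen, if_neg, map_zero, LinearMap.zero_apply]
    rintro rfl
    have hij : 1 + j = n + 1 := HasAntidiagonal.mem_antidiagonal.1 hij
    exact hne (by rw [show j = n by omega])
  · intro h
    exact absurd (HasAntidiagonal.mem_antidiagonal.2 (add_comm 1 n)) h

theorem comp_zero_bracket_gen (x : X) (f : Series K X) :
    comp 0 (bracket d (gen x) f) = 0 := by
  rw [comp_bracket, Nat.antidiagonal_zero, sum_singleton, comp_gen, if_neg zero_ne_one, map_zero,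
    LinearMap.zero_apply]

theorem eq_of_forall_comp_eq {f g : Series K X} (h : ∀ n, comp n f = comp n g) : f = g := by
  ext w
  have := congrArg (fun f : Series K X => f w) (h w.length)
  simpa [comp_apply] using this

variable [Fintype X]

/-- The sums of brackets of generators with elements of the free Lie algebra. -/
def genBrackets : Submodule K (Series K X) where
  carrier := {f | ∃ g : X → Series K X, (∀ x, g x ∈ freeLie d) ∧
    f = ∑ x, bracket d (gen x) (g x)}
  add_mem' := by
    rintro _ _ ⟨g, hg, rfl⟩ ⟨g', hg', rfl⟩
    exact ⟨g + g', fun x => add_mem (hg x) (hg' x), by simp [sum_add_distrib]⟩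
  zero_mem' := ⟨0, fun x => zero_mem _, by simp⟩
  smul_mem' := by
    rintro r _ ⟨g, hg, rfl⟩
    exact ⟨r • g, fun x => Submodule.smul_mem _ _ (hg x), by simp [smul_sum]⟩

theorem bracket_gen_mem_genBrackets (x : X) {f : Series K X} (hf : f ∈ freeLie d) :
    bracket d (gen x) f ∈ genBrackets d := by
  classical
  refine ⟨Pi.single x f, fun y => ?_, ?_⟩
  · by_cases h : y = x
    · subst h; simpa using hf
    · simp [h]
  · rw [sum_eq_single x]
    · simp
    · intro y _ hy
      simp [hy]
    · simp

/-- Jacobi rewrites iterated brackets so that the outermost left entry is a generator. Let `M`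
consist of those `f` for which every bracket of `f` with a Lie element has this form; it contains
the generators, and `[[f, g], h] = [f, [g, h]] ± [g, [f, h]]` shows that its Lie elements are closed
under bracket. -/
theorem bracket_mem_genBrackets [CharZero K] {f g : Series K X} (hf : f ∈ freeLie d) (hg : g ∈ freeLie d) :
    bracket d f g ∈ genBrackets d := by
  let M : Submodule K (Series K X) :=
    { carrier := {f | ∀ h ∈ freeLie d, bracket d f h ∈ genBrackets d}
      add_mem' := fun hf hf' h hh => by
        rw [map_add]; exact add_mem (hf h hh) (hf' h hh)
      zero_mem' := fun h _ => by rw [map_zero]; exact zero_mem _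
      smul_mem' := fun r f hf h hh => by
        rw [map_smul]; exact Submodule.smul_mem _ _ (hf h hh) }
  have hbr : ∀ {i j : ℤ} {f g : Series K X}, parity d f = (-1 : K) ^ i • f →
      parity d g = (-1 : K) ^ j • g → f ∈ M ⊓ freeLie d → g ∈ M ⊓ freeLie d →
      bracket d f g ∈ M := fun hpf hpg hf hg h hh => by
    rw [← sub_eq_iff_eq_add.2 (bracket_jacobi d h hpf hpg)]
    exact sub_mem (hf.1 _ (bracket_mem_freeLie d hg.2 hh))
      (Submodule.smul_mem _ _ (hg.1 _ (bracket_mem_freeLie d hf.2 hh)))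
  have hbr' : ∀ {f g : Series K X}, f ∈ M ⊓ freeLie d → parity d f ∈ M ⊓ freeLie d →
      g ∈ M ⊓ freeLie d → parity d g ∈ M ⊓ freeLie d → bracket d f g ∈ M ⊓ freeLie d := by
    intro f g hf hpf hg hpg
    refine ⟨?_, bracket_mem_freeLie d hf.2 hg.2⟩
    obtain ⟨f₀, f₁, rfl, hf₀, hf₁, hfS⟩ := exists_even_add_odd d f
    obtain ⟨g₀, g₁, rfl, hg₀, hg₁, hgS⟩ := exists_even_add_odd d g
    have hf := hfS _ hf hpf
    have hg := hgS _ hg hpg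
    rw [map_add (bracket d) f₀ f₁, LinearMap.add_apply, map_add, map_add]
    exact add_mem (add_mem (hbr hf₀ hg₀ hf.1 hg.1) (hbr hf₀ hg₁ hf.1 hg.2))
      (add_mem (hbr hf₁ hg₀ hf.2 hg.1) (hbr hf₁ hg₁ hf.2 hg.2))
  -- Stability under parity is carried through the induction so that elements can be split into even
  -- and odd parts.
  have hM : freeLie d ≤ (M ⊓ freeLie d) ⊓ (M ⊓ freeLie d).comap (parity d).toLinearMap := by
    have hgen : ∀ x, gen x ∈ M ⊓ freeLie d := fun x =>
      ⟨fun h hh => bracket_gen_mem_genBrackets d x hh, gen_mem_freeLie d x⟩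
    refine freeLie_le d (fun x => ⟨hgen x, ?_⟩) fun f hf g hg => ⟨hbr' hf.1 hf.2 hg.1 hg.2, ?_⟩
    · rw [SetLike.mem_coe, Submodule.mem_comap, AlgHom.toLinearMap_apply, parity_gen]
      exact Submodule.smul_mem _ _ (hgen x)
    · rw [SetLike.mem_coe, Submodule.mem_comap, AlgHom.toLinearMap_apply, parity_bracket]
      refine hbr' hf.2 ?_ hg.2 ?_
      · rw [parity_parity]; exact hf.1
      · rw [parity_parity]; exact hg.1
  exact (hM hf).1.1 g hg

theorem freeLie_le_span_gen_sup_genBrackets [CharZero K] :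
    (freeLie d : Submodule K (Series K X))
      ≤ freeLie d ⊓ (Submodule.span K (Set.range gen) ⊔ genBrackets d) :=
  freeLie_le d (fun x => ⟨gen_mem_freeLie d x,
    Submodule.mem_sup_left (Submodule.subset_span ⟨x, rfl⟩)⟩) fun _ hf _ hg =>
    ⟨bracket_mem_freeLie d hf.1 hg.1,
      Submodule.mem_sup_right (bracket_mem_genBrackets d hf.1 hg.1)⟩

/-- A Lie series of order at least `n + 1` is a sum of brackets of generators with Lie series of
order at least `n`. -/
theorem exists_eq_sum_bracket_gen [CharZero K] {n : ℕ} (hn : 1 ≤ n) {f : Series K X} (hf : f ∈ completeLie d)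
    (hfn : f ∈ ordGE (n + 1)) : ∃ g : X → Series K X, (∀ x, g x ∈ completeLie d) ∧
      (∀ x, g x ∈ ordGE n) ∧ f = ∑ x, bracket d (gen x) (g x) := by
  have key : ∀ k, ∃ g : X → Series K X, (∀ x, g x ∈ freeLie d) ∧ (k < n → g = 0) ∧
      comp (k + 1) f = ∑ x, bracket d (gen x) (comp k (g x)) := fun k => by
    by_cases hk : k < n
    · refine ⟨0, fun x => zero_mem _, fun _ => rfl, ?_⟩
      simp only [Pi.zero_apply, map_zero, sum_const_zero]
      ext w
      rw [comp_apply]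
      split_ifs with h
      · exact hfn w (by omega)
      · rfl
    · obtain ⟨v, hv, _, ⟨g, hg, rfl⟩, h⟩ :=
        Submodule.mem_sup.1 (freeLie_le_span_gen_sup_genBrackets d (hf (k + 1))).2
      refine ⟨g, hg, fun h => absurd h hk, ?_⟩
      have hcc : comp (k + 1) (comp (k + 1) f) = comp (k + 1) f := by
        ext w
        simp only [comp_apply]
        split_ifs <;> rfl
      -- Here `k ≥ n ≥ 1`, so the component has length at least two and a combination of generators
      -- does not contribute.
      have hv0 : comp (k + 1) v = 0 := by
        have : Submodule.span K (Set.range gen) ≤ LinearMap.ker (comp (K := K) (X := X) (k + 1)) := by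
          rw [Submodule.span_le]
          rintro _ ⟨x, rfl⟩
          rw [SetLike.mem_coe, LinearMap.mem_ker, comp_gen, if_neg (by omega)]
        exact this hv
      rw [← hcc, ← h, map_add, hv0, zero_add, map_sum]
      simp only [comp_succ_bracket_gen]
  choose G hG hG0 hGf using key
  -- The choices made in different lengths are glued into one series per generator, reading the
  -- length `k` component from the `k`-th choice.
  have hcomp : ∀ x k, comp k ⟨fun w => G w.length x w⟩ = comp k (G k x) := fun x k => by
    ext w
    simp only [comp_apply]
    split_ifs with h
    · rw [h]
    · rfl
  refine ⟨fun x => ⟨fun w => G w.length x w⟩, fun x k => ?_, fun x w hw => ?_, ?_⟩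
  · rw [hcomp]
    exact freeLie_le_completeLie d (hG k x) k
  · change G w.length x w = 0
    rw [hG0 _ hw]
    rfl
  · refine eq_of_forall_comp_eq fun k => ?_
    rw [map_sum]
    rcases k with - | k
    · simp only [comp_zero_bracket_gen, sum_const_zero]
      ext w
      rw [comp_apply]
      split_ifs with h
      · exact hfn w (by omega)
      · rfl
    · simp only [comp_succ_bracket_gen, hcomp, hGf]

end brackets

/-! ### The complete enveloping algebra of a complete free Lie algebra -/

section envelope

variable [CharZero K] [Fintype X] (d : X → ℤ) {c : X → Series K X}
  (hc : ∀ x, c x ∈ degPart d (d x - 1)) (hL : ∀ x, c x ∈ completeLie d)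

/-- The algebra map from the enveloping algebra of the complete free Lie algebra to series. -/
def ofEnvelope : (preDGL d c hc hL).U →ₐ[K] Series K X :=
  (preDGL d c hc hL).lift (completeLie d).subtype fun {i j x y} hx hy => by
    have h := bracket_of_parity d (congrArg Subtype.val hx) (congrArg Subtype.val hy)
    exact (add_eq_of_eq_sub' h).symm.trans (by rfl)

@[simp] theorem ofEnvelope_ι (x : (completeLie d : Submodule K (Series K X))) :
    ofEnvelope d hc hL ((preDGL d c hc hL).ι x) = x.1 :=
  (preDGL d c hc hL).lift_ι _ _ x

/-- A generator, as an element of the enveloping algebra. -/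
def envGen (x : X) : (preDGL d c hc hL).U :=
  (preDGL d c hc hL).ι ⟨gen x, gen_mem_completeLie d x⟩

/-- A word in the generators, as an element of the enveloping algebra. -/
def envWord (w : List X) : (preDGL d c hc hL).U := (w.map (envGen d hc hL)).prod

theorem ofEnvelope_envWord (w : List X) :
    ofEnvelope d hc hL (envWord d hc hL w) = (w.map gen).prod := by
  rw [envWord, map_list_prod, List.map_map]
  congr 2
  funext x
  exact ofEnvelope_ι d hc hL _

theorem envGen_mem_augIdeal (x : X) : envGen d hc hL x ∈ (preDGL d c hc hL).augIdeal :=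
  (preDGL d c hc hL).aug_ι _

theorem envWord_mem_pow (w : List X) :
    envWord d hc hL w ∈ (preDGL d c hc hL).augIdeal ^ w.length := by
  induction w with
  | nil => rw [List.length_nil, Submodule.pow_zero, Ideal.one_eq_top]; exact Submodule.mem_top
  | cons x w ih =>
    rw [envWord, List.map_cons, List.prod_cons, List.length_cons, Ideal.IsTwoSided.pow_succ]
    exact Ideal.mul_mem_mul (envGen_mem_augIdeal d hc hL x) ih

theorem ofEnvelope_nil (u : (preDGL d c hc hL).U) :
    ofEnvelope d hc hL u [] = (preDGL d c hc hL).aug u := by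
  induction u using (preDGL d c hc hL).U_induction with
  | hK r => simp [Algebra.algebraMap_eq_smul_one, one_apply]
  | hι x => rw [ofEnvelope_ι, PreDGL.aug_ι]; exact nil_of_mem_completeLie d x.2
  | hadd a b ha hb => rw [map_add, map_add, add_apply, ha, hb]
  | hmul a b ha hb => rw [map_mul, map_mul, mul_nil, ha, hb]

/-- The augmentation is the constant coefficient of the series, so elements of `I` have order at
least one, and orders add under products. -/
theorem ofEnvelope_mem_ordGE {n : ℕ} {u : (preDGL d c hc hL).U}
    (hu : u ∈ (preDGL d c hc hL).augIdeal ^ n) : ofEnvelope d hc hL u ∈ ordGE n := by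
  induction n generalizing u with
  | zero => exact mem_ordGE_zero _
  | succ n ih =>
    rw [Ideal.IsTwoSided.pow_succ] at hu
    induction hu using Submodule.smul_induction_on' with
    | smul a ha b hb =>
      rw [smul_eq_mul, map_mul, add_comm n]
      refine mul_mem_ordGE (fun w hw => ?_) (ih hb)
      rw [List.length_eq_zero_iff.1 (Nat.lt_one_iff.1 hw), ofEnvelope_nil]
      exact ha
    | add a _ b _ ha hb => rw [map_add]; exact add_mem ha hb

theorem ι_bracket {i j : ℤ} {x y : (completeLie d : Submodule K (Series K X))}
    (hx : parity d x.1 = (-1 : K) ^ i • x.1) (hy : parity d y.1 = (-1 : K) ^ j • y.1)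
    (h : bracket d x.1 y.1 ∈ completeLie d) :
    (preDGL d c hc hL).ι ⟨bracket d x.1 y.1, h⟩
      = (preDGL d c hc hL).ι x * (preDGL d c hc hL).ι y
        - (-1 : K) ^ (i * j) • ((preDGL d c hc hL).ι y * (preDGL d c hc hL).ι x) :=
  eq_sub_of_add_eq' ((preDGL d c hc hL).ι_mul_ι (Subtype.ext hx) (Subtype.ext hy)).symm

theorem smul_mem_augIdeal_pow {n : ℕ} (r : K) {u : (preDGL d c hc hL).U}
    (hu : u ∈ (preDGL d c hc hL).augIdeal ^ n) : r • u ∈ (preDGL d c hc hL).augIdeal ^ n :=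
  Submodule.smul_of_tower_mem _ r hu

theorem mul_mem_augIdeal_pow_succ {n : ℕ} {u v : (preDGL d c hc hL).U}
    (hu : u ∈ (preDGL d c hc hL).augIdeal ^ n) (hv : v ∈ (preDGL d c hc hL).augIdeal) :
    u * v ∈ (preDGL d c hc hL).augIdeal ^ (n + 1) := by
  rw [Submodule.pow_succ]
  exact Ideal.mul_mem_mul hu hv

/-- A Lie series of order `n` lies in the `n`-th power of the augmentation ideal. -/
theorem ι_mem_augIdeal_pow {n : ℕ} (hn : 1 ≤ n)
    {f : (completeLie d : Submodule K (Series K X))} (hf : f.1 ∈ ordGE n) :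
    (preDGL d c hc hL).ι f ∈ (preDGL d c hc hL).augIdeal ^ n := by
  induction n, hn using Nat.le_induction generalizing f with
  | base => rw [Submodule.pow_one]; exact (preDGL d c hc hL).aug_ι f
  | succ n hn ih =>
    -- The sum of brackets is finite, and each bracket becomes in `U` a graded commutator of an
    -- element of `I` with one of `Iⁿ`, by induction.
    obtain ⟨g, hg, hgn, hfg⟩ := exists_eq_sum_bracket_gen d hn f.2 hf
    have hbr : ∀ (x : X) {j : ℤ} {h : Series K X} (hh : h ∈ completeLie d)
        (_ : parity d h = (-1 : K) ^ j • h) (_ : h ∈ ordGE n),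
        (preDGL d c hc hL).ι ⟨bracket d (gen x) h,
          bracket_mem_completeLie d (gen_mem_completeLie d x) hh⟩
          ∈ (preDGL d c hc hL).augIdeal ^ (n + 1) := fun x j h hh hp hn => by
      rw [ι_bracket d hc hL (x := ⟨gen x, gen_mem_completeLie d x⟩) (y := ⟨h, hh⟩)
        (parity_gen d x) hp]
      refine sub_mem ?_ (smul_mem_augIdeal_pow d hc hL _ ?_)
      · rw [Ideal.IsTwoSided.pow_succ]
        exact Ideal.mul_mem_mul (envGen_mem_augIdeal d hc hL x) (ih (f := ⟨h, hh⟩) hn)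
      · exact mul_mem_augIdeal_pow_succ d hc hL (ih (f := ⟨h, hh⟩) hn)
          (envGen_mem_augIdeal d hc hL x)
    have hf' : f = ∑ x, (⟨bracket d (gen x) (g x),
        bracket_mem_completeLie d (gen_mem_completeLie d x) (hg x)⟩ :
          (completeLie d : Submodule K (Series K X))) := by
      ext1
      rw [hfg, Submodule.coe_sum]
    rw [hf', map_sum]
    refine sum_mem fun x _ => ?_
    obtain ⟨h₀, h₁, he, hp₀, hp₁, hS⟩ := exists_even_add_odd d (g x)
    have hS := hS (completeLie d ⊓ ordGE n) ⟨hg x, hgn x⟩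
      ⟨parity_mem_completeLie d (hg x), parity_mem_ordGE d (hgn x)⟩
    have := add_mem (hbr x hS.1.1 hp₀ hS.1.2) (hbr x hS.2.1 hp₁ hS.2.2)
    rw [← map_add] at this
    convert this using 3
    rw [he, map_add]
    rfl

/-- The span of the words in the enveloping algebra. -/
def envWords : Submodule K (preDGL d c hc hL).U :=
  Submodule.span K (Set.range (envWord d hc hL))

theorem envWord_mem_envWords (w : List X) : envWord d hc hL w ∈ envWords d hc hL :=
  Submodule.subset_span ⟨w, rfl⟩

theorem mul_mem_envWords {u v : (preDGL d c hc hL).U} (hu : u ∈ envWords d hc hL)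
    (hv : v ∈ envWords d hc hL) : u * v ∈ envWords d hc hL := by
  have h := Submodule.mul_mem_mul hu hv
  rw [envWords, Submodule.span_mul_span] at h
  refine Submodule.span_mono ?_ h
  rintro _ ⟨_, ⟨v, rfl⟩, _, ⟨w, rfl⟩, rfl⟩
  exact ⟨v ++ w, by simp [envWord]⟩

/-- Brackets become graded commutators in `U`, and the span of the words is closed under products,
so Lie polynomials are combinations of words there. The subspace `S` makes this an induction over
the free Lie algebra. -/
theorem ι_mem_envWords {f : (completeLie d : Submodule K (Series K X))} (hf : f.1 ∈ freeLie d) :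
    (preDGL d c hc hL).ι f ∈ envWords d hc hL := by
  let S : Submodule K (Series K X) :=
    ((envWords d hc hL).comap (preDGL d c hc hL).ι).map (completeLie d).subtype
  have hbr : ∀ {i j : ℤ} {f g : Series K X}, parity d f = (-1 : K) ^ i • f →
      parity d g = (-1 : K) ^ j • g → f ∈ S → g ∈ S → bracket d f g ∈ S := by
    rintro i j _ _ hpf hpg ⟨f, hf, rfl⟩ ⟨g, hg, rfl⟩
    refine ⟨⟨bracket d f.1 g.1, bracket_mem_completeLie d f.2 g.2⟩, ?_, rfl⟩
    rw [SetLike.mem_coe, Submodule.mem_comap, ι_bracket d hc hL hpf hpg]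
    exact sub_mem (mul_mem_envWords d hc hL hf hg)
      (Submodule.smul_mem _ _ (mul_mem_envWords d hc hL hg hf))
  have hbr' : ∀ {f g : Series K X}, f ∈ S → parity d f ∈ S → g ∈ S → parity d g ∈ S →
      bracket d f g ∈ S := by
    intro f g hf hpf hg hpg
    obtain ⟨f₀, f₁, rfl, hf₀, hf₁, hfS⟩ := exists_even_add_odd d f
    obtain ⟨g₀, g₁, rfl, hg₀, hg₁, hgS⟩ := exists_even_add_odd d g
    have hf := hfS _ hf hpf
    have hg := hgS _ hg hpg
    rw [map_add (bracket d) f₀ f₁, LinearMap.add_apply, map_add, map_add]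
    exact add_mem (add_mem (hbr hf₀ hg₀ hf.1 hg.1) (hbr hf₀ hg₁ hf.1 hg.2))
      (add_mem (hbr hf₁ hg₀ hf.2 hg.1) (hbr hf₁ hg₁ hf.2 hg.2))
  have hgen : ∀ x, gen x ∈ S := fun x => ⟨⟨gen x, gen_mem_completeLie d x⟩, by
    have := envWord_mem_envWords d hc hL [x]
    rwa [envWord, List.map_singleton, List.prod_singleton] at this, rfl⟩
  have hS : freeLie d ≤ S ⊓ S.comap (parity d).toLinearMap := by
    refine freeLie_le d (fun x => ⟨hgen x, ?_⟩) fun f hf g hg => ⟨hbr' hf.1 hf.2 hg.1 hg.2, ?_⟩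
    · rw [SetLike.mem_coe, Submodule.mem_comap, AlgHom.toLinearMap_apply, parity_gen]
      exact Submodule.smul_mem _ _ (hgen x)
    · rw [SetLike.mem_coe, Submodule.mem_comap, AlgHom.toLinearMap_apply, parity_bracket]
      refine hbr' hf.2 ?_ hg.2 ?_
      · rw [parity_parity]; exact hf.1
      · rw [parity_parity]; exact hg.1
  obtain ⟨g, hg, hgf⟩ := (hS hf).1
  rwa [← Subtype.ext hgf]

/-- Words are dense in `U` for the `I`-adic topology. On a Lie series, the components of length less
than `n` are Lie polynomials and the tail lies in `Iⁿ`; products are handled because `Iⁿ` is a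
two-sided ideal. -/
theorem exists_envWords_sub_mem (n : ℕ) (u : (preDGL d c hc hL).U) :
    ∃ v ∈ envWords d hc hL, u - v ∈ (preDGL d c hc hL).augIdeal ^ n := by
  rcases n.eq_zero_or_pos with rfl | hn
  · exact ⟨0, zero_mem _, by rw [Submodule.pow_zero, Ideal.one_eq_top]; exact Submodule.mem_top⟩
  induction u using (preDGL d c hc hL).U_induction with
  | hK r =>
    refine ⟨_, ?_, by rw [sub_self]; exact zero_mem _⟩
    rw [Algebra.algebraMap_eq_smul_one]
    exact Submodule.smul_mem _ _ (envWord_mem_envWords d hc hL [])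
  | hι f =>
    have hcomp : ∀ k, comp k f.1 ∈ completeLie d := fun k => freeLie_le_completeLie d (f.2 k)
    refine ⟨∑ k ∈ range n, (preDGL d c hc hL).ι ⟨comp k f.1, hcomp k⟩,
      sum_mem fun k _ => ι_mem_envWords d hc hL (f.2 k), ?_⟩
    rw [← map_sum, ← map_sub]
    refine ι_mem_augIdeal_pow d hc hL hn fun w hw => ?_
    rw [AddSubgroupClass.coe_sub, Submodule.coe_sum, sub_apply, sum_apply,
      sum_eq_single w.length]
    · simp [comp_apply]
    · intro k _ hk
      simp [comp_apply, Ne.symm hk]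
    · intro h
      exact absurd (mem_range.2 hw) h
  | hadd a b ha hb =>
    obtain ⟨v, hv, hav⟩ := ha
    obtain ⟨w, hw, hbw⟩ := hb
    exact ⟨v + w, add_mem hv hw, by rw [add_sub_add_comm]; exact add_mem hav hbw⟩
  | hmul a b ha hb =>
    obtain ⟨v, hv, hav⟩ := ha
    obtain ⟨w, hw, hbw⟩ := hb
    refine ⟨v * w, mul_mem_envWords d hc hL hv hw, ?_⟩
    rw [show a * b - v * w = (a - v) * b + v * (b - w) by noncomm_ring]
    exact add_mem (Ideal.mul_mem_right _ _ hav) (Ideal.mul_mem_left _ _ hbw)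

/-- An element of the enveloping algebra lies in the `n`-th power of the augmentation ideal if and
only if its series has order at least `n`. -/
theorem mem_augIdeal_pow_iff {n : ℕ} {u : (preDGL d c hc hL).U} :
    u ∈ (preDGL d c hc hL).augIdeal ^ n ↔ ofEnvelope d hc hL u ∈ ordGE n := by
  classical
  refine ⟨ofEnvelope_mem_ordGE d hc hL, fun hu => ?_⟩
  -- It suffices to treat a combination of words. Order at least `n` kills the coefficients of the
  -- words shorter than `n`, since words are independent as series; the longer words lie in `Iⁿ`.
  obtain ⟨v, hv, huv⟩ := exists_envWords_sub_mem d hc hL n u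
  have hv0 : ofEnvelope d hc hL v ∈ ordGE n := by
    have := sub_mem hu (ofEnvelope_mem_ordGE d hc hL huv)
    rwa [map_sub, sub_sub_cancel] at this
  rw [← sub_add_cancel u v]
  refine add_mem huv ?_
  obtain ⟨r, rfl⟩ := (Finsupp.mem_span_range_iff_exists_finsupp).1 hv
  refine sum_mem fun w _ => ?_
  by_cases hw : w.length < n
  · have h := hv0 w hw
    rw [Finsupp.sum, map_sum, sum_apply] at h
    simp only [map_smul, ofEnvelope_envWord, smul_apply, prod_map_gen_apply, mul_ite, mul_one,
      mul_zero, sum_ite_eq, Finsupp.mem_support_iff, ite_not, ite_eq_left_iff] at h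
    have h : r w = 0 := by
      by_contra h'
      exact h' (h h')
    simp only [h, zero_smul]
    exact zero_mem _
  · exact smul_mem_augIdeal_pow d hc hL _
      (Ideal.pow_le_pow_right (not_lt.1 hw) (envWord_mem_pow d hc hL w))

theorem proj_eq_proj_iff {n : ℕ} {u v : (preDGL d c hc hL).U} :
    (preDGL d c hc hL).proj n u = (preDGL d c hc hL).proj n v
      ↔ ofEnvelope d hc hL u - ofEnvelope d hc hL v ∈ ordGE n := by
  rw [← map_sub, ← mem_augIdeal_pow_iff]
  exact Ideal.Quotient.eq

theorem ofEnvelope_parityU (u : (preDGL d c hc hL).U) :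
    ofEnvelope d hc hL ((preDGL d c hc hL).parityU u) = parity d (ofEnvelope d hc hL u) := by
  induction u using (preDGL d c hc hL).U_induction with
  | hK r => simp
  | hι x => rw [PreDGL.parityU_ι, ofEnvelope_ι, ofEnvelope_ι]; rfl
  | hadd a b ha hb => simp only [map_add, ha, hb]
  | hmul a b ha hb => simp only [map_mul, ha, hb]

theorem ofEnvelope_diffU (u : (preDGL d c hc hL).U) :
    ofEnvelope d hc hL ((preDGL d c hc hL).diffU u) = deriv d c (ofEnvelope d hc hL u) := by
  induction u using (preDGL d c hc hL).U_induction with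
  | hK r =>
    rw [PreDGL.diffU_algebraMap, map_zero, AlgHom.commutes, Algebra.algebraMap_eq_smul_one,
      map_smul, deriv_one, smul_zero]
  | hι x => rw [PreDGL.diffU_ι, ofEnvelope_ι, ofEnvelope_ι]; rfl
  | hadd a b ha hb => simp only [map_add, ha, hb]
  | hmul a b ha hb =>
    rw [PreDGL.diffU_mul, map_add, map_mul, map_mul, map_mul, deriv_mul, ha, hb,
      ofEnvelope_parityU]

theorem ofEnvelope_mem_degPart {p : ℤ} {u : (preDGL d c hc hL).U}
    (hu : u ∈ (preDGL d c hc hL).degU p) : ofEnvelope d hc hL u ∈ degPart d p := by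
  induction hu using Submodule.span_induction with
  | mem u hu =>
    induction hu with
    | one => rw [map_one]; exact one_mem_degPart d
    | mul hx _ ih => rw [map_mul, ofEnvelope_ι]; exact mul_mem_degPart d hx ih
  | zero => rw [map_zero]; exact zero_mem _
  | add a b _ _ ha hb => rw [map_add]; exact add_mem ha hb
  | smul r a _ ha => rw [map_smul]; exact Submodule.smul_mem _ _ ha

theorem envWord_mem_degU (w : List X) :
    envWord d hc hL w ∈ (preDGL d c hc hL).degU (wordDeg d w) := by
  induction w with
  | nil => exact Submodule.subset_span .one
  | cons x w ih =>
    rw [envWord, List.map_cons, List.prod_cons, wordDeg_cons]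
    exact (preDGL d c hc hL).mul_mem_degU
      ((preDGL d c hc hL).ι_mem_degU (gen_mem_degPart d x)) ih

/-- The truncation of a series, as an element of the enveloping algebra. -/
def envTrunc (n : ℕ) (f : Series K X) : (preDGL d c hc hL).U :=
  ∑ w ∈ wordsLT X n, f w • envWord d hc hL w

theorem ofEnvelope_envTrunc_sub_mem (n : ℕ) (f : Series K X) :
    ofEnvelope d hc hL (envTrunc d hc hL n f) - f ∈ ordGE n := by
  have h := sum_wordsLT_sub_mem_ordGE n f
  rw [envTrunc, map_sum]
  simpa only [map_smul, ofEnvelope_envWord] using h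

/-- An element of `U` represents `f` modulo `Iⁿ` as soon as its series agrees with `f` below length
`n`. All the algebraic identities for `toEnvelope` reduce to this criterion. -/
theorem proj_envTrunc_eq_iff {n : ℕ} {f : Series K X} {u : (preDGL d c hc hL).U} :
    (preDGL d c hc hL).proj n (envTrunc d hc hL n f) = (preDGL d c hc hL).proj n u
      ↔ ofEnvelope d hc hL u - f ∈ ordGE n := by
  have h := ofEnvelope_envTrunc_sub_mem d hc hL n f
  rw [eq_comm, proj_eq_proj_iff]
  constructor
  · intro h'
    simpa using add_mem h' h
  · intro h'
    simpa using sub_mem h' h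

/-- The map from series to the complete enveloping algebra. -/
def toEnvelope : Series K X →ₐ[K] (preDGL d c hc hL).completeU :=
  AlgHom.ofLinearMap
    { toFun := fun f => ⟨fun n => (preDGL d c hc hL).proj n (envTrunc d hc hL n f), fun n => by
        refine ((proj_envTrunc_eq_iff d hc hL).2 ?_).symm
        exact ordGE_anti n.le_succ (ofEnvelope_envTrunc_sub_mem d hc hL (n + 1) f)⟩
      map_add' := fun f g => by
        ext n
        refine ((proj_envTrunc_eq_iff d hc hL).2 ?_).trans (map_add _ _ _)
        rw [map_add, add_sub_add_comm]
        exact add_mem (ofEnvelope_envTrunc_sub_mem d hc hL n f)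
          (ofEnvelope_envTrunc_sub_mem d hc hL n g)
      map_smul' := fun r f => by
        ext n
        refine ((proj_envTrunc_eq_iff d hc hL).2 ?_).trans (map_smul _ r _)
        rw [map_smul, ← smul_sub]
        exact Submodule.smul_mem _ _ (ofEnvelope_envTrunc_sub_mem d hc hL n f) }
    (by
      ext n
      refine ((proj_envTrunc_eq_iff d hc hL).2 ?_).trans (map_one _)
      rw [map_one, sub_self]
      exact zero_mem _)
    (fun f g => by
      ext n
      refine ((proj_envTrunc_eq_iff d hc hL).2 ?_).trans (map_mul _ _ _)
      have hf := ofEnvelope_envTrunc_sub_mem d hc hL n f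
      have hg := ofEnvelope_envTrunc_sub_mem d hc hL n g
      rw [map_mul]
      generalize ofEnvelope d hc hL (envTrunc d hc hL n f) = f' at hf
      generalize ofEnvelope d hc hL (envTrunc d hc hL n g) = g' at hg
      rw [show f' * g' - f * g = (f' - f) * g' + f * (g' - g) by noncomm_ring]
      have h := mul_mem_ordGE (mem_ordGE_zero f) hg
      rw [zero_add] at h
      exact add_mem (mul_mem_ordGE hf (mem_ordGE_zero g')) h)

theorem toEnvelope_apply (f : Series K X) (n : ℕ) :
    (toEnvelope d hc hL f).1 n = (preDGL d c hc hL).proj n (envTrunc d hc hL n f) := rfl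

theorem toEnvelope_apply_eq_iff {n : ℕ} {f : Series K X} {u : (preDGL d c hc hL).U} :
    (toEnvelope d hc hL f).1 n = (preDGL d c hc hL).proj n u
      ↔ ofEnvelope d hc hL u - f ∈ ordGE n := proj_envTrunc_eq_iff d hc hL

theorem toEnvelope_injective : Function.Injective (toEnvelope d hc hL) := fun f g h => by
  refine eq_of_forall_sub_mem_ordGE fun n => ?_
  have h1 := (toEnvelope_apply_eq_iff d hc hL).1 (toEnvelope_apply d hc hL f n)
  have h2 := (toEnvelope_apply_eq_iff d hc hL).1 (h ▸ toEnvelope_apply d hc hL f n)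
  simpa using sub_mem h2 h1

theorem toEnvelope_surjective : Function.Surjective (toEnvelope d hc hL) := fun s => by
  choose u hu using fun n => (preDGL d c hc hL).proj_surjective n (s.1 n)
  -- Compatible lifts have series that agree below length `m` from stage `m` on.
  have hle : ∀ m k, ofEnvelope d hc hL (u (m + k)) - ofEnvelope d hc hL (u m) ∈ ordGE m := by
    intro m k
    induction k with
    | zero => rw [add_zero, sub_self]; exact zero_mem _
    | succ k ih =>
      have h : (preDGL d c hc hL).proj (m + k) (u (m + k + 1))
          = (preDGL d c hc hL).proj (m + k) (u (m + k)) := by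
        rw [hu, ← s.2 (m + k), ← hu (m + k + 1)]
        rfl
      rw [proj_eq_proj_iff] at h
      simpa [add_assoc] using add_mem (ordGE_anti (Nat.le_add_right m k) h) ih
  -- Stage `w.length + 1` is the first one that determines the coefficient of `w`.
  refine ⟨⟨fun w => ofEnvelope d hc hL (u (w.length + 1)) w⟩, ?_⟩
  ext n
  rw [← hu n, toEnvelope_apply_eq_iff]
  intro w hw
  obtain ⟨k, rfl⟩ := Nat.exists_eq_add_of_le (Nat.succ_le_of_lt hw)
  exact hle (w.length + 1) k w (Nat.lt_succ_self _)

/-- The complete enveloping algebra of the complete free Lie algebra is the complete tensor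
algebra. -/
def envelopeEquiv : Series K X ≃ₐ[K] (preDGL d c hc hL).completeU :=
  AlgEquiv.ofBijective (toEnvelope d hc hL)
    ⟨toEnvelope_injective d hc hL, toEnvelope_surjective d hc hL⟩

theorem envelopeEquiv_coe (f : (completeLie d : Submodule K (Series K X))) :
    envelopeEquiv d hc hL f.1 = (preDGL d c hc hL).ιc f := by
  ext n
  refine (toEnvelope_apply_eq_iff d hc hL).2 ?_
  rw [ofEnvelope_ι, sub_self]
  exact zero_mem _

theorem envelopeEquiv_isIso :
    (preDGA d c hc).IsIso (preDGL d c hc hL).envelope (envelopeEquiv d hc hL) where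
  mem_deg_iff p f := by
    constructor
    · intro h w hw
      obtain ⟨u, hu, huf⟩ := h (w.length + 1)
      have h1 := (toEnvelope_apply_eq_iff d hc hL).1 huf.symm w (Nat.lt_succ_self _)
      rw [sub_apply, ofEnvelope_mem_degPart d hc hL hu w hw, zero_sub, neg_eq_zero] at h1
      exact h1
    · intro hf n
      -- The truncation is itself a lift of degree `p`: each of its words has degree `p` or
      -- coefficient zero.
      refine ⟨_, sum_mem fun w _ => ?_, (toEnvelope_apply d hc hL f n).symm⟩
      by_cases hw : wordDeg d w = p
      · subst hw
        exact Submodule.smul_mem _ _ (envWord_mem_degU d hc hL w)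
      · rw [hf w hw, zero_smul]
        exact zero_mem _
  map_parity f := by
    ext n
    refine (toEnvelope_apply_eq_iff d hc hL (u := (preDGL d c hc hL).parityU _)).2 ?_
    rw [ofEnvelope_parityU]
    change _ - parity d f ∈ _
    rw [← map_sub]
    exact parity_mem_ordGE d (ofEnvelope_envTrunc_sub_mem d hc hL n f)
  map_diff f := by
    ext n
    refine (toEnvelope_apply_eq_iff d hc hL (u := (preDGL d c hc hL).diffU _)).2 ?_
    rw [ofEnvelope_diffU]
    change _ - deriv d c f ∈ _
    rw [← map_sub]
    exact deriv_mem_ordGE d (fun x => nil_of_mem_completeLie d (hL x))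
      (ofEnvelope_envTrunc_sub_mem d hc hL n f)

end envelope

end

end Series

noncomputable section

/-! ### Isomorphisms of graded algebras with a derivation -/

namespace PreDGA.IsIso

variable {K A B C : Type*} [Field K] [Ring A] [Algebra K A] [Ring B] [Algebra K B] [Ring C]
  [Algebra K C] {𝒜 : PreDGA K A} {ℬ : PreDGA K B} {𝒞 : PreDGA K C} {φ : A ≃ₐ[K] B} {ψ : B ≃ₐ[K] C}

theorem symm (h : 𝒜.IsIso ℬ φ) : ℬ.IsIso 𝒜 φ.symm where
  mem_deg_iff p x := by rw [← h.mem_deg_iff, φ.apply_symm_apply]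
  map_parity x := φ.injective <| by
    rw [φ.apply_symm_apply, h.map_parity, φ.apply_symm_apply]
  map_diff x := φ.injective <| by
    rw [φ.apply_symm_apply, h.map_diff, φ.apply_symm_apply]

theorem trans (h : 𝒜.IsIso ℬ φ) (h' : ℬ.IsIso 𝒞 ψ) : 𝒜.IsIso 𝒞 (φ.trans ψ) where
  mem_deg_iff p x := by rw [AlgEquiv.trans_apply, h'.mem_deg_iff, h.mem_deg_iff]
  map_parity x := by simp only [AlgEquiv.trans_apply, h.map_parity, h'.map_parity]
  map_diff x := by simp only [AlgEquiv.trans_apply, h.map_diff, h'.map_diff]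

theorem isDGA (h : 𝒜.IsIso ℬ φ) (hℬ : ℬ.IsDGA) : 𝒜.IsDGA := fun x => φ.injective <| by
  rw [h.map_diff, h.map_diff, hℬ, map_zero]

end PreDGA.IsIso

namespace Series

variable {K X Y : Type*} [Field K]

/-! ### Renaming generators -/

/-- The isomorphism of complete tensor algebras given by a bijection of the generators. -/
def relabel (e : X ≃ Y) : Series K X ≃ₐ[K] Series K Y :=
  AlgEquiv.ofLinearEquiv
    { toFun := fun f => ⟨fun w => f (w.map e.symm)⟩
      invFun := fun f => ⟨fun w => f (w.map e)⟩
      map_add' := fun _ _ => rfl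
      map_smul' := fun _ _ => rfl
      left_inv := fun f => by ext w; simp
      right_inv := fun f => by ext w; simp }
    (by
      ext w
      change (1 : Series K X) (w.map e.symm) = _
      rw [one_apply, one_apply, List.length_map])
    (fun f g => by
      ext w
      change (f * g) (w.map e.symm) = _
      rw [mul_apply, mul_apply, List.length_map]
      refine sum_congr rfl fun i _ => ?_
      rw [← List.map_take, ← List.map_drop]
      rfl)

theorem relabel_apply (e : X ≃ Y) (f : Series K X) (w : List Y) :
    relabel e f w = f (w.map e.symm) := rfl

theorem relabel_gen (e : X ≃ Y) (x : X) : relabel e (gen x : Series K X) = gen (e x) := by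
  ext w
  rw [relabel_apply]
  by_cases h : w = [e x]
  · simp [gen, h]
  · have h' : w.map e.symm ≠ [x] := fun h' => h <| by
      have := congrArg (List.map e) h'
      simpa using this
    simp [gen, h, h']

theorem relabel_formalSum (e : X ≃ Y) (t : ℕ → Series K X) :
    relabel e (formalSum t) = formalSum fun n => relabel e (t n) := by
  ext w
  simp [formalSum, relabel_apply]

section graded

variable {d : X → ℤ} {d' : Y → ℤ} {e : X ≃ Y}

theorem wordDeg_map_symm (hd : ∀ x, d' (e x) = d x) (w : List Y) :
    wordDeg d (w.map e.symm) = wordDeg d' w := by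
  induction w with
  | nil => rfl
  | cons y w ih => rw [List.map_cons, wordDeg_cons, wordDeg_cons, ih, ← hd, e.apply_symm_apply]

theorem relabel_deriv [Fintype X] [Fintype Y] (hd : ∀ x, d' (e x) = d x) {c : X → Series K X}
    {c' : Y → Series K Y} (hcc : ∀ x, relabel e (c x) = c' (e x)) (f : Series K X) :
    relabel e (deriv d c f) = deriv d' c' (relabel e f) := by
  ext w
  rw [relabel_apply, deriv_apply, deriv_apply, List.length_map]
  refine sum_congr rfl fun i _ => sum_congr rfl fun j _ => Fintype.sum_equiv e _ _ fun x => ?_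
  rw [← hcc, relabel_apply, relabel_apply, ← List.map_take, ← List.map_drop, ← List.map_take,
    wordDeg_map_symm hd]
  simp

theorem relabel_isIso [Fintype X] [Fintype Y] (hd : ∀ x, d' (e x) = d x) {c : X → Series K X}
    {c' : Y → Series K Y} (hcc : ∀ x, relabel e (c x) = c' (e x))
    (hc : ∀ x, c x ∈ degPart d (d x - 1)) (hc' : ∀ y, c' y ∈ degPart d' (d' y - 1)) :
    (preDGA d c hc).IsIso (preDGA d' c' hc') (relabel e) where
  mem_deg_iff p f := by
    constructor
    · intro h w hw
      have := h (w.map e) (by rw [← wordDeg_map_symm hd]; simpa using hw)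
      simpa [relabel_apply] using this
    · intro h w hw
      exact h _ (by rwa [wordDeg_map_symm hd])
  map_parity f := by
    ext w
    change parity d f (w.map e.symm) = parity d' (relabel e f) w
    rw [parity_apply, parity_apply, wordDeg_map_symm hd]
    rfl
  map_diff := relabel_deriv hd hcc

end graded

/-! ### Formulas for the Lawrence–Sullivan series -/

section gauge

variable [CharZero K]

/-- This unfolds the operator form, convenient for the square of `∂`, into powers of left minus
right multiplication, from which the two given differentials are read off. -/
theorem gaugeSeries_eq (a b z : Series K X) :
    gaugeSeries a b z = z * b - b * z + formalSum fun n =>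
      (((bernoulli n : ℚ) : K) / (n.factorial : K)) •
        ((LinearMap.mulLeft K z - LinearMap.mulRight K z) ^ n) (b - a) := by
  rw [gaugeSeries, seriesAction_apply]
  congr 2
  funext n
  rw [PowerSeries.coeff_rescale, bernoulliPowerSeries, PowerSeries.coeff_mk, map_mul,
    Module.End.mul_apply, biaction_algebraMap_rat, map_smul, map_pow, map_sub (biaction z), biaction_leftVar,
    biaction_rightVar]
  push_cast
  rfl

theorem relabel_gaugeSeries (e : X ≃ Y) (a b z : Series K X) :
    relabel e (gaugeSeries a b z) = gaugeSeries (relabel e a) (relabel e b) (relabel e z) := by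
  have h : ∀ (n : ℕ) (g : Series K X),
      relabel e (((LinearMap.mulLeft K z - LinearMap.mulRight K z) ^ n) g)
        = ((LinearMap.mulLeft K (relabel e z) - LinearMap.mulRight K (relabel e z)) ^ n)
          (relabel e g) := fun n => by
    induction n with
    | zero => intro g; rfl
    | succ n ih => intro g; rw [pow_succ, pow_succ, Module.End.mul_apply, ih]; simp
  simp only [gaugeSeries_eq, map_add, map_sub, map_mul, relabel_formalSum, map_smul, h]

end gauge

end Series

/-! ### The differentials on generators, and the conclusion. -/

open Series

theorem LSGen.diff_a (K : Type*) [Field K] [CharZero K] :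
    LSGen.diff K .a = -(gen .a * gen .a) := by
  have h : Series.parity LSGen.deg (gen .a : Series K LSGen) = -gen .a := by
    rw [parity_gen]; simp [LSGen.deg]
  rw [LSGen.diff, bracket_odd _ h, h, neg_mul, sub_neg_eq_add, ← two_smul K, smul_smul]
  simp

theorem LSGen.diff_b (K : Type*) [Field K] [CharZero K] :
    LSGen.diff K .b = -(gen .b * gen .b) := by
  have h : Series.parity LSGen.deg (gen .b : Series K LSGen) = -gen .b := by
    rw [parity_gen]; simp [LSGen.deg]
  rw [LSGen.diff, bracket_odd _ h, h, neg_mul, sub_neg_eq_add, ← two_smul K, smul_smul]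
  simp

theorem LSGen.diff_z (K : Type*) [Field K] [CharZero K] :
    LSGen.diff K .z = gaugeSeries (gen .a) (gen .b) (gen .z) := by
  have h : Series.parity LSGen.deg (gen .z : Series K LSGen) = gen .z := by
    rw [parity_gen]; simp [LSGen.deg]
  have h' : bracket LSGen.deg (gen .z : Series K LSGen)
      = LinearMap.mulLeft K (gen .z) - LinearMap.mulRight K (gen .z) := by
    ext1 g
    exact bracket_even _ h g
  rw [LSGen.diff, h', gaugeSeries_eq]
  simp only [Module.End.pow_apply]
  rfl

/-- Left multiplication commutes with the negative of right multiplication, so the binomial theorem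
applies; the binomial coefficient divided by `n!` is `1 / (p! q!)`, and the sign `(-1)^q` comes from
the right multiplications. -/
theorem CylGen.diff_su (K : Type*) [Field K] [CharZero K] :
    CylGen.diff K .su = gaugeSeries (gen .u) (gen .u') (gen .su) := by
  rw [CylGen.diff, gaugeSeries_eq]
  congr 2
  funext n
  have hcomm := (LinearMap.commute_mulLeft_right (R := K) (gen .su : Series K CylGen)
    (gen .su)).neg_right
  rw [sub_eq_add_neg (LinearMap.mulLeft K _), hcomm.add_pow', LinearMap.sum_apply, smul_sum]
  refine sum_congr rfl fun p hp => ?_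
  have hp := HasAntidiagonal.mem_antidiagonal.1 hp
  subst hp
  have hneg : (-LinearMap.mulRight K (gen .su : Series K CylGen)) ^ p.2
      = (-1 : K) ^ p.2 • LinearMap.mulRight K (gen .su ^ p.2) := by
    rw [← neg_one_smul K, smul_pow, LinearMap.pow_mulRight]
  have hfac : (((p.1 + p.2).choose p.1 : ℕ) : K) * (p.1.factorial * p.2.factorial)
      = (p.1 + p.2).factorial := by
    rw [← mul_assoc, Nat.choose_symm_add]
    exact_mod_cast Nat.add_choose_mul_factorial_mul_factorial p.1 p.2
  have h1 : (p.1.factorial : K) ≠ 0 := Nat.cast_ne_zero.2 p.1.factorial_ne_zero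
  have h2 : (p.2.factorial : K) ≠ 0 := Nat.cast_ne_zero.2 p.2.factorial_ne_zero
  have h3 : ((p.1 + p.2).factorial : K) ≠ 0 := Nat.cast_ne_zero.2 (Nat.factorial_ne_zero _)
  rw [hneg, LinearMap.pow_mulLeft, ← Nat.cast_smul_eq_nsmul K, LinearMap.smul_apply,
    Module.End.mul_apply, LinearMap.smul_apply, LinearMap.mulRight_apply, map_smul,
    LinearMap.mulLeft_apply, smul_smul, smul_smul, mul_assoc (gen CylGen.su ^ p.1 : Series K CylGen)]
  congr 1
  rw [← hfac] at h3 ⊢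
  have h4 := left_ne_zero_of_mul h3
  field_simp

/-- The bijection `a ↦ u`, `b ↦ u'`, `z ↦ su` of generators. -/
def genEquiv : LSGen ≃ CylGen where
  toFun
    | .a => .u
    | .b => .u'
    | .z => .su
  invFun
    | .u => .a
    | .u' => .b
    | .su => .z
  left_inv x := by cases x <;> rfl
  right_inv x := by cases x <;> rfl

theorem deg_genEquiv (x : LSGen) : CylGen.deg (genEquiv x) = LSGen.deg x := by cases x <;> rfl

theorem relabel_diff (K : Type*) [Field K] [CharZero K] (x : LSGen) :
    relabel genEquiv (LSGen.diff K x) = CylGen.diff K (genEquiv x) := by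
  cases x with
  | a => rw [LSGen.diff_a, map_neg, map_mul, relabel_gen]; rfl
  | b => rw [LSGen.diff_b, map_neg, map_mul, relabel_gen]; rfl
  | z =>
    rw [LSGen.diff_z, relabel_gaugeSeries, relabel_gen, relabel_gen, relabel_gen]
    exact (CylGen.diff_su K).symm

theorem deriv_deriv_LSGen (K : Type*) [Field K] [CharZero K] (f : Series K LSGen) :
    Series.deriv LSGen.deg (LSGen.diff K) (Series.deriv LSGen.deg (LSGen.diff K) f) = 0 := by
  have hc := LSGen.diff_mem_degPart K
  have h0 : ∀ x, LSGen.diff K x [] = 0 := fun x =>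
    nil_of_mem_completeLie LSGen.deg (LSGen.diff_mem_completeLie K x)
  refine Series.deriv_deriv_eq_zero LSGen.deg hc h0 (fun x => ?_) f
  -- For an odd generator with `∂x = -x²`, the two terms of `∂(x²)` are `-x³` and `x³`.
  have hsq : ∀ x, LSGen.deg x = -1 → LSGen.diff K x = -(gen x * gen x) →
      Series.deriv LSGen.deg (LSGen.diff K) (LSGen.diff K x) = 0 := fun x hx h => by
    rw [h, map_neg, Series.deriv_mul, deriv_gen, parity_gen, hx, h]
    simp [mul_assoc]
  cases x with
  | a => exact hsq _ rfl (LSGen.diff_a K)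
  | b => exact hsq _ rfl (LSGen.diff_b K)
  | z =>
    exact deriv_gaugeSeries_eq_zero LSGen.deg hc h0 (a := .a) (b := .b) (z := .z) rfl rfl
      (LSGen.diff_a K) (LSGen.diff_b K) (LSGen.diff_z K)

end

theorem mainTheorem1 (K : Type*) [Field K] [CharZero K] :
    (lawrenceSullivan K).IsDGL ∧
    (lawrenceSullivan K).envelope.IsDGA ∧
    (completeCylinder K).IsDGA ∧
    ∃ φ : (lawrenceSullivan K).completeU ≃ₐ[K] Series K CylGen,
      (lawrenceSullivan K).envelope.IsIso (completeCylinder K) φ ∧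
      φ ((lawrenceSullivan K).ιc (lsGen K LSGen.a)) = Series.gen CylGen.u ∧
      φ ((lawrenceSullivan K).ιc (lsGen K LSGen.b)) = Series.gen CylGen.u' ∧
      φ ((lawrenceSullivan K).ιc (lsGen K LSGen.z)) = Series.gen CylGen.su := by
  have hc := LSGen.diff_mem_degPart K
  have hL := LSGen.diff_mem_completeLie K
  have h1 : (Series.preDGA LSGen.deg (LSGen.diff K) hc).IsIso (lawrenceSullivan K).envelope
      (Series.envelopeEquiv LSGen.deg hc hL) := Series.envelopeEquiv_isIso LSGen.deg hc hL
  have h2 : (Series.preDGA LSGen.deg (LSGen.diff K) hc).IsIso (completeCylinder K) (Series.relabel genEquiv) :=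
    Series.relabel_isIso deg_genEquiv (relabel_diff K) hc (CylGen.diff_mem_degPart K)
  have h0 : (Series.preDGA LSGen.deg (LSGen.diff K) hc).IsDGA := deriv_deriv_LSGen K
  have hgen : ∀ x, ((Series.envelopeEquiv LSGen.deg hc hL).symm.trans (Series.relabel genEquiv))
      ((lawrenceSullivan K).ιc (lsGen K x)) = Series.gen (genEquiv x) := fun x => by
    have h : Series.envelopeEquiv LSGen.deg hc hL (Series.gen x) = (lawrenceSullivan K).ιc (lsGen K x) :=
      Series.envelopeEquiv_coe LSGen.deg hc hL (lsGen K x)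
    rw [← h, AlgEquiv.trans_apply, AlgEquiv.symm_apply_apply, Series.relabel_gen]
  -- The square is computed only on the tensor algebra on `a`, `b`, `z`: it restricts to the Lie
  -- series and is carried to the other two algebras by the isomorphisms.
  exact ⟨fun x => Subtype.ext (deriv_deriv_LSGen K x.1), h1.symm.isDGA h0, h2.symm.isDGA h0, _,
    h1.symm.trans h2, hgen .a, hgen .b, hgen .z⟩
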